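/- Let $n\ge 1$. Let $LP(n)$ be the set of non-crossing perfect matchings (link patterns) $\pi$ of $2n$ cyclically ordered points $1,\dots,2n$; write $\pi(i)$ for the partner of $i$ and read indices modulo $2n$. On $\mathbb{C}^{LP(n)}$, with basis $|\pi\rangle$, let $R$ be the rotation, which replaces every arc $(i,j)$ by $(i-1,j-1)$. For $1\le j\le 2n$ let $e_j|\pi\rangle=|e_j(\pi)\rangle$, where $e_j(\pi)=\pi$ if $\pi(j)=j+1$, and otherwise $e_j(\pi)$ is obtained from $\pi$ by replacing the arcs $(j,\pi(j))$, $(j+1,\pi(j+1))$ by $(j,j+1)$, $(\pi(j),\pi(j+1))$. Put $H_n=\sum_{j=1}^{2n}e_j$ and $\mathrm{Sym}=\sum_{k=0}^{2n-1}R^k$. Consider the $n\times n$ square of the square lattice, with its $4n$ external edges (legs) numbered counter-clockwise, starting from the vertical one at the bottom-left corner. Let $Fpl(n,+)$ (respectively $Fpl(n,-)$) be the set of black/white colourings $\phi$ of all edges, external ones included, in which each vertex is adjacent to two black and two white edges, and the external edges are alternately coloured, the first one black (respectively white). Label the $2n$ black legs by $1,\dots,2n$ in the above order. Then $\pi(\phi)\in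 LP(n)$ is the pairing of the black legs induced by the black open paths of $\phi$. On $\mathbb{C}^{Fpl(n,\pm)}$, with basis $|\phi\rangle\rangle$, let $\Pi_\pm|\phi\rangle\rangle=|\pi(\phi)\rangle$ and $|s_{n,\pm}\rangle\rangle=\sum_{\phi\in Fpl(n,\pm)}|\phi\rangle\rangle$, and put $|s_n\rangle=\sum_{\phi\in Fpl(n,+)}|\pi(\phi)\rangle$. For a plaquette (unit square face) $\alpha$ let $\mathcal{N}_\alpha(\phi)=+1$ if the two horizontal edges of $\alpha$ are black and the two vertical ones are white, $-1$ if the two horizontal edges are white and the two vertical ones are black, and $0$ otherwise; let $\widetilde{\mathcal N}_\alpha|\phi\rangle\rangle=\mathcal{N}_\alpha(\phi)|\phi\rangle\rangle$. Let $\alpha_j$ be the plaquette in column $2j-1$ of the bottom row, i.e. the one whose lower-left corner is the $(2j-1)$-th vertex of the bottom row; if $n$ is odd and $j=\lceil n/2\rceil$ there is no such plaquette, and $\widetilde{\mathcal N}_{\alpha_j}=0$. Then, for either choice of the sign $\pm$ on the right-hand side, $$\mathsf{RS}_n:=(H_n-2n)\,|s_n\rangle=\sum_{j=1}^{\lceil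 n/2\rceil}\mathrm{Sym}\;\Pi_\pm\,\widetilde{\mathcal N}_{\alpha_j}\,|s_{n,\pm}\rangle\rangle .$$ Moreover, for either sign, if for all $\pi\in LP(n)$ and all plaquettes $\alpha$ the sum of $\mathcal{N}_\alpha(\phi)$ over the $\phi\in Fpl(n,\pm)$ such that $\pi(\phi)$ is a rotation of $\pi$ vanishes, then $H_n|s_n\rangle=2n\,|s_n\rangle$. -/

import Mathlib

open scoped BigOperators

namespace RazStr

/-! ## Link patterns -/

/-- The set `LP(n)` of link patterns: non-crossing perfect matchings of the `2n` cyclically ordered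
points `0, …, 2n-1`, given by the map sending a point to its partner. -/
structure LP (n : ℕ) where
  partner : Fin (2 * n) → Fin (2 * n)
  partner_partner : ∀ i, partner (partner i) = i
  partner_ne : ∀ i, partner i ≠ i
  noncrossing : ∀ a b, ¬ (a < b ∧ b < partner a ∧ partner a < partner b)

/-- The cyclic successor `i ↦ i + 1` on the `2n` labels. -/
def next (n : ℕ) : Equiv.Perm (Fin (2 * n)) := finRotate (2 * n)

theorem next_val {n : ℕ} (i : Fin (2 * n)) :
    ((next n i : Fin (2 * n)) : ℕ) = if (i : ℕ) + 1 = 2 * n then 0 else (i : ℕ) + 1 := by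
  unfold next
  generalize 2 * n = m at i
  cases m with
  | zero => exact i.elim0
  | succ m =>
    rw [finRotate_apply]
    split_ifs with h
    · have : i = Fin.last m := by ext; simp; omega
      simp [this]
    · rw [Fin.val_add_one_of_lt]
      rw [Fin.lt_def]; simp; omega

theorem next_ne {n : ℕ} (i : Fin (2 * n)) : next n i ≠ i := by
  intro h
  have h1 := congrArg Fin.val h
  rw [next_val] at h1
  have := i.isLt
  split_ifs at h1 <;> omega

/-- The rotation `R`: the arcs `(i, j)` of `π` become the arcs `(i - 1, j - 1)`. -/
def rotate {n : ℕ} (π : LP n) : LP n where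
  partner i := (next n).symm (π.partner (next n i))
  partner_partner i := by simp [π.partner_partner]
  partner_ne i h := by
    rw [Equiv.symm_apply_eq] at h
    exact π.partner_ne _ h
  noncrossing a b := by
    rintro ⟨h1, h2, h3⟩
    generalize hc : (next n).symm (π.partner (next n a)) = c at *
    generalize hd : (next n).symm (π.partner (next n b)) = d at *
    rw [Equiv.symm_apply_eq] at hc hd
    have hnc1 := π.noncrossing (next n a) (next n b)
    have hnc2 := π.noncrossing (next n d) (next n a)
    have hd' : π.partner (next n d) = next n b := by rw [← hd, π.partner_partner]
    rw [hc, hd] at hnc1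
    rw [hc, hd'] at hnc2
    simp only [Fin.lt_def, next_val] at *
    have := a.isLt
    have := b.isLt
    have := c.isLt
    have := d.isLt
    split_ifs at * <;> omega

theorem LP.inside_of_inside {n : ℕ} (π : LP n) {b x : Fin (2 * n)} (hx : b < x)
    (hx' : x < π.partner b) : b < π.partner x ∧ π.partner x < π.partner b := by
  have h1 := π.noncrossing b x
  have h2 := π.noncrossing (π.partner x) b
  have h3 : π.partner x ≠ π.partner b := fun h => by
    have := congrArg π.partner h
    rw [π.partner_partner, π.partner_partner] at this
    exact hx.ne' this
  have h4 : π.partner x ≠ b := fun h => by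
    rw [← h, π.partner_partner] at hx'
    exact lt_irrefl _ hx'
  rw [π.partner_partner] at h2
  rw [← Fin.val_ne_iff] at h3 h4
  simp only [Fin.lt_def] at *
  omega

theorem LP.inside_iff {n : ℕ} (π : LP n) {b x : Fin (2 * n)} :
    (b < x ∧ x < π.partner b) ↔ (b < π.partner x ∧ π.partner x < π.partner b) := by
  refine ⟨fun h => π.inside_of_inside h.1 h.2, fun h => ?_⟩
  have := π.inside_of_inside h.1 h.2
  rwa [π.partner_partner] at this

/-- The Temperley-Lieb map `e_j`: it fixes `π` if `j` and `j + 1` are partners, and otherwise it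
replaces the arcs `(j, π(j))`, `(j + 1, π(j + 1))` by `(j, j + 1)`, `(π(j), π(j + 1))`. -/
def temperleyLieb {n : ℕ} (j : Fin (2 * n)) (π : LP n) : LP n :=
  if hj : π.partner j = next n j then π else
  { partner := fun i =>
      if i = j then next n j
      else if i = next n j then j
      else if i = π.partner j then π.partner (next n j)
      else if i = π.partner (next n j) then π.partner j
      else π.partner i
    partner_partner := by
      intro i
      have h1 := π.partner_partner
      have h2 := π.partner_ne
      have h3 := next_ne j
      grind
    partner_ne := by
      intro i
      have h1 := π.partner_partner
      have h2 := π.partner_ne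
      have h3 := next_ne j
      grind
    noncrossing := by
      have h1 := π.partner_partner
      have h2 := π.partner_ne
      have h3 := next_ne j
      have key : ∀ b, b < π.partner b → b ≠ j → b ≠ next n j → π.partner b ≠ j →
          π.partner b ≠ next n j → ((b < π.partner j ∧ π.partner j < π.partner b) ↔
            (b < π.partner (next n j) ∧ π.partner (next n j) < π.partner b)) := by
        intro b hb hbj hbk hdj hdk
        rw [← π.inside_iff (x := j), ← π.inside_iff (x := next n j)]
        have h4 := next_val j
        have := (π.partner b).isLt
        have := (next n j).isLt
        rw [← Fin.val_ne_iff] at hbj hbk hdj hdk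
        simp only [Fin.lt_def] at *
        split_ifs at h4 <;> omega
      have arc : ∀ x y, (if x = j then next n j
          else if x = next n j then j
          else if x = π.partner j then π.partner (next n j)
          else if x = π.partner (next n j) then π.partner j
          else π.partner x) = y →
          (x = j ∧ y = next n j ∨ x = next n j ∧ y = j) ∨
          (x = π.partner j ∧ y = π.partner (next n j) ∨
            x = π.partner (next n j) ∧ y = π.partner j) ∨
          (π.partner x = y ∧ x ≠ j ∧ x ≠ next n j ∧ y ≠ j ∧ y ≠ next n j) := by
        intro x y
        grind
      rintro a b ⟨k1, k2, k3⟩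
      have ha := arc a _ rfl
      have hb := arc b _ rfl
      generalize (if a = j then next n j
        else if a = next n j then j
        else if a = π.partner j then π.partner (next n j)
        else if a = π.partner (next n j) then π.partner j
        else π.partner a) = c at *
      generalize (if b = j then next n j
        else if b = next n j then j
        else if b = π.partner j then π.partner (next n j)
        else if b = π.partner (next n j) then π.partner j
        else π.partner b) = d at *
      have hnc := π.noncrossing a b
      have ka := key a
      have kb := key b
      have h4 := next_val j
      have := d.isLt
      clear arc key h1 h2 h3 hj
      generalize next n j = k at *
      generalize π.partner j = p at *
      generalize π.partner k = q at *
      rcases ha with ha | ha | ⟨ha, ha1, ha2, ha3, ha4⟩ <;>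
      rcases hb with hb | hb | ⟨hb, hb1, hb2, hb3, hb4⟩
      all_goals
        try rw [ha] at hnc ka
        try rw [hb] at hnc kb
        simp only [Fin.lt_def, Fin.ext_iff, Ne] at *
      all_goals split_ifs at h4 <;> omega }

/-! ## Fully-packed loops on the `n × n` square -/

/-- The vertices `(x, y)` of the `n × n` square: `x` is the column, counted from the left, and `y`
the row, counted from the bottom, both from `0`. -/
abbrev Vertex (n : ℕ) : Type := Fin n × Fin n

/-- The edges of the `n × n` square, boundary edges included. `Sum.inl (x, y)` is the horizontal
edge in row `y` on the left of column `x` (so on the right of column `x - 1`), and `Sum.inr (x, y)`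
is the vertical edge in column `x` below row `y` (so above row `y - 1`). -/
abbrev Edge (n : ℕ) : Type := (Fin (n + 1) × Fin n) ⊕ (Fin n × Fin (n + 1))

/-- The left, right, lower and upper edge at a vertex. -/
def incident {n : ℕ} (w : Vertex n) : Finset (Edge n) :=
  {Sum.inl (w.1.castSucc, w.2), Sum.inl (w.1.succ, w.2),
   Sum.inr (w.1, w.2.castSucc), Sum.inr (w.1, w.2.succ)}

/-- The ice rule for an edge colouring (`true` is black, `false` is white): each vertex is adjacent
to exactly two black edges (hence to exactly two white ones). -/
def IceRule {n : ℕ} (φ : Edge n → Bool) : Prop :=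
  ∀ w : Vertex n, ((incident w).filter (fun e => φ e = true)).card = 2

/-- The `4n` boundary edges (external legs), in counter-clockwise order, starting from the vertical
one at the bottom-left corner: bottom side, right side, top side, left side. -/
def leg {n : ℕ} (k : Fin (4 * n)) : Edge n :=
  if h1 : (k : ℕ) < n then Sum.inr (⟨k, h1⟩, 0)
  else if h2 : (k : ℕ) < 2 * n then Sum.inl (Fin.last n, ⟨k - n, by omega⟩)
  else if h3 : (k : ℕ) < 3 * n then Sum.inr (⟨3 * n - 1 - k, by omega⟩, Fin.last n)
  else Sum.inl (0, ⟨4 * n - 1 - k, by omega⟩)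

/-- The two alternating boundary conditions `τ₊ = (bwbw…bw)` and `τ₋ = (wbwb…wb)`. -/
inductive Sgn : Type
  | plus
  | minus

/-- The position, among the `4n` legs, of the `i`-th black leg. -/
def blackIndex {n : ℕ} : Sgn → Fin (2 * n) → Fin (4 * n)
  | Sgn.plus, i => ⟨2 * i, by omega⟩
  | Sgn.minus, i => ⟨2 * i + 1, by omega⟩

/-- The alternating boundary condition: a leg is black if and only if its position is even (for
`τ₊`), respectively odd (for `τ₋`). -/
def HasBoundary {n : ℕ} : Sgn → (Edge n → Bool) → Prop
  | Sgn.plus, φ => ∀ k : Fin (4 * n), φ (leg k) = true ↔ Even (k : ℕ)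
  | Sgn.minus, φ => ∀ k : Fin (4 * n), φ (leg k) = true ↔ Odd (k : ℕ)

/-- The ensemble `Fpl(n, ±)` of fully-packed loop configurations. -/
def Fpl (n : ℕ) (σ : Sgn) : Type :=
  {φ : Edge n → Bool // IceRule φ ∧ HasBoundary σ φ}

noncomputable instance (n : ℕ) (σ : Sgn) : Fintype (Fpl n σ) := by
  classical
  exact inferInstanceAs (Fintype {φ : Edge n → Bool // IceRule φ ∧ HasBoundary σ φ})

/-- The graph whose edges are the pairs of black edges sharing a vertex of the square: the black
paths and cycles of `φ` are its connected components. -/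
def blackGraph {n : ℕ} (φ : Edge n → Bool) : SimpleGraph (Edge n) where
  Adj e e' := e ≠ e' ∧ φ e = true ∧ φ e' = true ∧ ∃ w, e ∈ incident w ∧ e' ∈ incident w
  symm := ⟨fun _ _ ⟨h1, h2, h3, w, h4, h5⟩ => ⟨h1.symm, h3, h2, w, h5, h4⟩⟩
  loopless := ⟨fun _ h => h.1 rfl⟩

/-- The `i`-th and the `j`-th black leg are joined by a black path of `φ`. -/
def Joined {n : ℕ} {σ : Sgn} (φ : Fpl n σ) (i j : Fin (2 * n)) : Prop :=
  (blackGraph φ.1).Reachable (leg (blackIndex σ i)) (leg (blackIndex σ j))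

/-! The black paths induce a link pattern: each black leg is joined to exactly one other one (a
count of degrees), and the resulting matching is non-crossing (a two-colouring of the faces). -/

theorem blackGraph_black {n : ℕ} {φ : Edge n → Bool} {e e' : Edge n} (he : φ e = true)
    (h : (blackGraph φ).Reachable e e') : φ e' = true := by
  obtain ⟨p⟩ := h
  induction p with
  | nil => exact he
  | cons h _ ih => exact ih h.2.2.1

/-- The value of `p` on horizontal edges, with natural number coordinates. -/
def hVal {n : ℕ} (p : Edge n → ZMod 2) (x y : ℕ) : ZMod 2 :=
  if h : x < n + 1 ∧ y < n then p (Sum.inl (⟨x, h.1⟩, ⟨y, h.2⟩)) else 0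

/-- The value of `p` on vertical edges, with natural number coordinates. -/
def vVal {n : ℕ} (p : Edge n → ZMod 2) (x y : ℕ) : ZMod 2 :=
  if h : x < n ∧ y < n + 1 then p (Sum.inr (⟨x, h.1⟩, ⟨y, h.2⟩)) else 0

theorem hVal_eq {n : ℕ} (p : Edge n → ZMod 2) (x : Fin (n + 1)) (y : Fin n) :
    p (Sum.inl (x, y)) = hVal p x y := by
  unfold hVal; rw [dif_pos ⟨x.isLt, y.isLt⟩]

theorem vVal_eq {n : ℕ} (p : Edge n → ZMod 2) (x : Fin n) (y : Fin (n + 1)) :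
    p (Sum.inr (x, y)) = vVal p x y := by
  unfold vVal; rw [dif_pos ⟨x.isLt, y.isLt⟩]

/-- The colour of the face whose upper-right corner is the vertex `(x, y)`. -/
def faceVal {n : ℕ} (p : Edge n → ZMod 2) (x y : ℕ) : ZMod 2 :=
  ∑ i ∈ Finset.range y, hVal p 0 i + ∑ i ∈ Finset.range x, vVal p i y

theorem faceVal_right {n : ℕ} (p : Edge n → ZMod 2) (x y : ℕ) :
    faceVal p (x + 1) y = faceVal p x y + vVal p x y := by
  simp [faceVal, Finset.sum_range_succ, add_assoc]

theorem sum_incident {n : ℕ} (p : Edge n → ZMod 2) (w : Vertex n) :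
    ∑ e ∈ incident w, p e = hVal p w.1 w.2 + hVal p (w.1 + 1) w.2 +
      vVal p w.1 w.2 + vVal p w.1 (w.2 + 1) := by
  unfold incident
  have h1 : w.1.castSucc ≠ w.1.succ := Fin.castSucc_lt_succ.ne
  have h2 : w.2.castSucc ≠ w.2.succ := Fin.castSucc_lt_succ.ne
  rw [Finset.sum_insert (by simp [h1]), Finset.sum_insert (by simp),
    Finset.sum_insert (by simp [h2]), Finset.sum_singleton]
  simp only [hVal_eq, vVal_eq, Fin.val_castSucc, Fin.val_succ]
  ring

theorem faceVal_up {n : ℕ} (p : Edge n → ZMod 2)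
    (hp : ∀ w : Vertex n, ∑ e ∈ incident w, p e = 0) (x y : ℕ) (hx : x ≤ n) (hy : y < n) :
    faceVal p x (y + 1) = faceVal p x y + hVal p x y := by
  induction x with
  | zero => simp [faceVal, Finset.sum_range_succ]
  | succ x ih =>
    have h := hp (⟨x, hx⟩, ⟨y, hy⟩)
    rw [sum_incident] at h
    dsimp only at h
    rw [faceVal_right, faceVal_right, ih (by omega)]
    have h2 : (2 : ZMod 2) = 0 := rfl
    linear_combination h - (hVal p (x + 1) y + vVal p x y) * h2

/-- The colour of the boundary face preceding the `k`-th leg in counter-clockwise order. -/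
def bdryVal {n : ℕ} (p : Edge n → ZMod 2) (k : ℕ) : ZMod 2 :=
  if k ≤ n then faceVal p k 0
  else if k ≤ 2 * n then faceVal p n (k - n)
  else if k ≤ 3 * n then faceVal p (3 * n - k) n
  else faceVal p 0 (4 * n - k)

theorem bdryVal_succ {n : ℕ} (p : Edge n → ZMod 2)
    (hp : ∀ w : Vertex n, ∑ e ∈ incident w, p e = 0) (k : Fin (4 * n)) :
    bdryVal p (k + 1) = bdryVal p k + p (leg k) := by
  obtain ⟨k, hk⟩ := k
  have h2 : (2 : ZMod 2) = 0 := rfl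
  simp only [leg]
  split_ifs with h1 h3 h4
  · rw [vVal_eq p, bdryVal, if_pos (by omega), bdryVal, if_pos (by omega), faceVal_right]
    rfl
  · rw [hVal_eq p]
    have e1 : bdryVal p (k + 1) = faceVal p n (k - n + 1) := by
      rw [bdryVal, if_neg (by omega), if_pos (by omega)]; congr 1; omega
    have e2 : bdryVal p k = faceVal p n (k - n) := by
      rw [bdryVal]
      by_cases h4 : k ≤ n
      · have : k = n := by omega
        subst this; simp
      · rw [if_neg h4, if_pos h3.le]
    rw [e1, e2, faceVal_up p hp _ _ le_rfl (by omega)]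
    rfl
  · rw [vVal_eq p]
    have e1 : bdryVal p (k + 1) = faceVal p (3 * n - 1 - k) n := by
      rw [bdryVal, if_neg (by omega), if_neg (by omega), if_pos (by omega)]; congr 1; omega
    have e2 : bdryVal p k = faceVal p (3 * n - 1 - k + 1) n := by
      rw [bdryVal, if_neg (by omega)]
      by_cases h5 : k ≤ 2 * n
      · rw [if_pos h5]; congr 1 <;> omega
      · rw [if_neg h5, if_pos h4.le]; congr 1; omega
    rw [e1, e2, faceVal_right]
    simp only [Fin.val_last]
    linear_combination - vVal p (3 * n - 1 - k) n * h2
  · rw [hVal_eq p]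
    have e1 : bdryVal p (k + 1) = faceVal p 0 (4 * n - 1 - k) := by
      rw [bdryVal, if_neg (by omega), if_neg (by omega), if_neg (by omega)]; congr 1; omega
    have e2 : bdryVal p k = faceVal p 0 (4 * n - 1 - k + 1) := by
      rw [bdryVal]; split_ifs
      · omega
      · omega
      · congr 1 <;> omega
      · congr 1; omega
    rw [e1, e2, faceVal_up p hp _ _ (by omega) (by omega)]
    simp only [Fin.val_zero]
    linear_combination - hVal p 0 (4 * n - 1 - k) * h2

theorem bdryVal_eq_sum {n : ℕ} (p : Edge n → ZMod 2)
    (hp : ∀ w : Vertex n, ∑ e ∈ incident w, p e = 0) (k : ℕ) (hk : k ≤ 4 * n) :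
    bdryVal p k = ∑ i ∈ Finset.univ.filter (fun i : Fin (4 * n) => (i : ℕ) < k), p (leg i) := by
  induction k with
  | zero => simp [bdryVal, faceVal]
  | succ k ih =>
    have := bdryVal_succ p hp ⟨k, hk⟩
    dsimp only at this
    rw [this, ih (by omega)]
    have h : (Finset.univ.filter fun i : Fin (4 * n) => (i : ℕ) < k + 1) =
        insert ⟨k, hk⟩ (Finset.univ.filter fun i : Fin (4 * n) => (i : ℕ) < k) := by
      ext i
      simp [Fin.ext_iff]
      omega
    rw [h, Finset.sum_insert (by simp), add_comm]

theorem sum_leg {n : ℕ} (p : Edge n → ZMod 2)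
    (hp : ∀ w : Vertex n, ∑ e ∈ incident w, p e = 0) :
    ∑ i : Fin (4 * n), p (leg i) = 0 := by
  have h := bdryVal_eq_sum p hp (4 * n) le_rfl
  rw [Finset.filter_true_of_mem (by simp)] at h
  rw [← h, bdryVal]
  split_ifs with h1 h2 h3
  · have : n = 0 := by omega
    subst this; simp [faceVal]
  · have : n = 0 := by omega
    subst this; simp [faceVal]
  · have : n = 0 := by omega
    subst this; simp [faceVal]
  · simp [faceVal]

/-- The colour of the face on the left of (respectively, below) an edge. -/
def sideVal {n : ℕ} (p : Edge n → ZMod 2) : Edge n → ZMod 2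
  | Sum.inl (x, y) => faceVal p x y
  | Sum.inr (x, y) => faceVal p x y

theorem sideVal_leg {n : ℕ} (p : Edge n → ZMod 2)
    (hp : ∀ w : Vertex n, ∑ e ∈ incident w, p e = 0) (k : Fin (4 * n)) (hk : p (leg k) = 0) :
    sideVal p (leg k) = bdryVal p k := by
  have hs := bdryVal_succ p hp k
  rw [hk, add_zero] at hs
  obtain ⟨k, hk'⟩ := k
  dsimp only at hs
  by_cases h1 : k < n
  · simp only [leg, dif_pos h1, sideVal, bdryVal, if_pos h1.le, Fin.val_zero]
  by_cases h2 : k < 2 * n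
  · simp only [leg, dif_neg h1, dif_pos h2, sideVal, bdryVal, Fin.val_last]
    by_cases h3 : k ≤ n
    · have : k = n := by omega
      subst this; simp
    · rw [if_neg h3, if_pos h2.le]
  dsimp only
  rw [← hs]
  by_cases h3 : k < 3 * n
  · simp only [leg, dif_neg h1, dif_neg h2, dif_pos h3, sideVal, bdryVal, Fin.val_last]
    rw [if_neg (by omega), if_neg (by omega), if_pos (by omega)]
    congr 1; omega
  · simp only [leg, dif_neg h1, dif_neg h2, dif_neg h3, sideVal, bdryVal, Fin.val_zero]
    rw [if_neg (by omega), if_neg (by omega), if_neg (by omega)]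
    congr 1; omega

theorem sideVal_incident {n : ℕ} (p : Edge n → ZMod 2)
    (hp : ∀ w : Vertex n, ∑ e ∈ incident w, p e = 0) (w : Vertex n)
    (hw : ∀ e ∈ incident w, p e = 0) (e : Edge n) (he : e ∈ incident w) :
    sideVal p e = faceVal p w.1 w.2 := by
  obtain ⟨x, y⟩ := w
  have h1 := hw (Sum.inl (x.castSucc, y)) (by simp [incident])
  have h2 := hw (Sum.inr (x, y.castSucc)) (by simp [incident])
  rw [hVal_eq p] at h1
  rw [vVal_eq p] at h2
  simp only [incident, Finset.mem_insert, Finset.mem_singleton] at he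
  rcases he with rfl | rfl | rfl | rfl
  · rfl
  · simp only [sideVal, Fin.val_succ, faceVal_right]
    simpa using h2
  · rfl
  · simp only [sideVal, Fin.val_succ]
    rw [faceVal_up p hp _ _ x.isLt.le y.isLt]
    simpa using h1

/-- The indicator of the black component of `e₀`. -/
noncomputable def compVal {n : ℕ} (φ : Edge n → Bool) (e₀ e : Edge n) : ZMod 2 := by
  classical
  exact if (blackGraph φ).Reachable e₀ e then 1 else 0

theorem compVal_incident {n : ℕ} {φ : Edge n → Bool} (hφ : IceRule φ) {e₀ : Edge n}
    (h₀ : φ e₀ = true) (w : Vertex n) :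
    ∃ e₁ e₂, e₁ ≠ e₂ ∧ e₁ ∈ incident w ∧ e₂ ∈ incident w ∧ φ e₁ = true ∧ φ e₂ = true ∧
      (∀ e ∈ incident w, φ e = true → e = e₁ ∨ e = e₂) ∧
      compVal φ e₀ e₁ = compVal φ e₀ e₂ ∧
      ∀ e ∈ incident w, e ≠ e₁ → e ≠ e₂ → compVal φ e₀ e = 0 := by
  obtain ⟨e₁, e₂, hne, h⟩ := Finset.card_eq_two.mp (hφ w)
  have hmem : ∀ e, e ∈ incident w ∧ φ e = true ↔ e = e₁ ∨ e = e₂ := by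
    intro e
    have := Finset.ext_iff.mp h e
    simpa using this
  have m1 := (hmem e₁).2 (Or.inl rfl)
  have m2 := (hmem e₂).2 (Or.inr rfl)
  refine ⟨e₁, e₂, hne, m1.1, m2.1, m1.2, m2.2, fun e he hb => (hmem e).1 ⟨he, hb⟩, ?_, ?_⟩
  · have hadj : (blackGraph φ).Adj e₁ e₂ := ⟨hne, m1.2, m2.2, w, m1.1, m2.1⟩
    have : (blackGraph φ).Reachable e₀ e₁ ↔ (blackGraph φ).Reachable e₀ e₂ :=
      ⟨fun h => h.trans hadj.reachable, fun h => h.trans hadj.symm.reachable⟩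
    unfold compVal
    by_cases h : (blackGraph φ).Reachable e₀ e₁
    · rw [if_pos h, if_pos (this.1 h)]
    · rw [if_neg h, if_neg (fun h' => h (this.2 h'))]
  · intro e he n1 n2
    unfold compVal
    rw [if_neg]
    intro hr
    rcases (hmem e).1 ⟨he, blackGraph_black h₀ hr⟩ with h | h
    · exact n1 h
    · exact n2 h

theorem compVal_sum {n : ℕ} {φ : Edge n → Bool} (hφ : IceRule φ) {e₀ : Edge n}
    (h₀ : φ e₀ = true) (w : Vertex n) : ∑ e ∈ incident w, compVal φ e₀ e = 0 := by
  obtain ⟨e₁, e₂, hne, m1, m2, -, -, -, heq, hz⟩ := compVal_incident hφ h₀ w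
  rw [← Finset.sum_subset (s₁ := {e₁, e₂}) (by
      intro e he; simp at he; rcases he with rfl | rfl <;> assumption) (by
      intro e he hn; simp at hn; exact hz e he hn.1 hn.2)]
  rw [Finset.sum_pair hne, heq]
  have h2 : (2 : ZMod 2) = 0 := rfl
  linear_combination compVal φ e₀ e₂ * h2

theorem compVal_eq_zero {n : ℕ} {φ : Edge n → Bool} {e₀ e : Edge n} :
    compVal φ e₀ e = 0 ↔ ¬ (blackGraph φ).Reachable e₀ e := by
  unfold compVal
  split_ifs with h <;> simp [h]

theorem sideVal_reachable {n : ℕ} {φ : Edge n → Bool} (hφ : IceRule φ) {e₀ : Edge n}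
    (h₀ : φ e₀ = true) {e e' : Edge n} (h : (blackGraph φ).Reachable e e')
    (he : ¬ (blackGraph φ).Reachable e₀ e) :
    sideVal (compVal φ e₀) e = sideVal (compVal φ e₀) e' := by
  obtain ⟨q⟩ := h
  induction q with
  | nil => rfl
  | @cons a b c hadj _ ih =>
    have hb : ¬ (blackGraph φ).Reachable e₀ b := fun h => he (h.trans hadj.symm.reachable)
    rw [← ih hb]
    obtain ⟨hne, ha1, hb1, w, ha2, hb2⟩ := hadj
    obtain ⟨e₁, e₂, -, m1, m2, -, -, hall, heq, hz⟩ := compVal_incident hφ h₀ w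
    have hw : ∀ e ∈ incident w, compVal φ e₀ e = 0 := by
      have ha0 := compVal_eq_zero.2 he
      have key : compVal φ e₀ e₁ = 0 ∧ compVal φ e₀ e₂ = 0 := by
        rcases hall a ha2 ha1 with rfl | rfl
        · exact ⟨ha0, heq ▸ ha0⟩
        · exact ⟨heq.trans ha0, ha0⟩
      intro e he'
      by_cases n1 : e = e₁
      · rw [n1]; exact key.1
      by_cases n2 : e = e₂
      · rw [n2]; exact key.2
      exact hz e he' n1 n2
    have hp := compVal_sum hφ h₀
    rw [sideVal_incident _ hp w hw a ha2, sideVal_incident _ hp w hw b hb2]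

/-- The endpoints, inside the square, of an edge. -/
noncomputable def endpoints {n : ℕ} (e : Edge n) : Finset (Vertex n) :=
  Finset.univ.filter fun w => e ∈ incident w

theorem mem_incident_inl {n : ℕ} (x : Fin (n + 1)) (y : Fin n) (w : Vertex n) :
    (Sum.inl (x, y) : Edge n) ∈ incident w ↔
      (w.2 : ℕ) = y ∧ ((w.1 : ℕ) = x ∨ (w.1 : ℕ) + 1 = x) := by
  simp [incident, Fin.ext_iff]
  omega

theorem mem_incident_inr {n : ℕ} (x : Fin n) (y : Fin (n + 1)) (w : Vertex n) :
    (Sum.inr (x, y) : Edge n) ∈ incident w ↔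
      (w.1 : ℕ) = x ∧ ((w.2 : ℕ) = y ∨ (w.2 : ℕ) + 1 = y) := by
  simp [incident, Fin.ext_iff]
  omega

theorem card_endpoints {n : ℕ} (e : Edge n) : (endpoints e).card ≤ 2 := by
  by_contra! h
  obtain ⟨a, b, c, ha, hb, hc, hab, hac, hbc⟩ := Finset.two_lt_card_iff.mp h
  simp only [endpoints, Finset.mem_filter, Finset.mem_univ, true_and] at ha hb hc
  simp only [Ne, Prod.ext_iff, Fin.ext_iff] at hab hac hbc
  rcases e with ⟨x, y⟩ | ⟨x, y⟩
  · rw [mem_incident_inl] at ha hb hc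
    omega
  · rw [mem_incident_inr] at ha hb hc
    omega

theorem card_endpoints_leg {n : ℕ} (k : Fin (4 * n)) : (endpoints (leg k)).card ≤ 1 := by
  rw [Finset.card_le_one]
  intro a ha b hb
  simp only [endpoints, Finset.mem_filter, Finset.mem_univ, true_and] at ha hb
  simp only [Prod.ext_iff, Fin.ext_iff]
  have := a.1.isLt
  have := a.2.isLt
  have := b.1.isLt
  have := b.2.isLt
  unfold leg at ha hb
  split_ifs at ha hb <;>
    simp only [mem_incident_inl, mem_incident_inr, Fin.val_zero, Fin.val_last] at ha hb <;> omega

theorem card_le_endpoints {n : ℕ} {φ : Edge n → Bool} (hφ : IceRule φ) (e : Edge n)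
    (T : Finset (Edge n)) (hT : ∀ e' ∈ T, (blackGraph φ).Adj e e') :
    T.card ≤ (endpoints e).card := by
  classical
  have h : ∀ e', ∃ w, e' ∈ T → e ∈ incident w ∧ e' ∈ incident w := by
    intro e'
    by_cases he : e' ∈ T
    · obtain ⟨-, -, -, w, h1, h2⟩ := hT e' he
      exact ⟨w, fun _ => ⟨h1, h2⟩⟩
    · rcases isEmpty_or_nonempty (Vertex n) with h0 | ⟨⟨w⟩⟩
      · exfalso
        rcases e' with ⟨x, y⟩ | ⟨x, y⟩
        · exact h0.elim (y, y)
        · exact h0.elim (x, x)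
      · exact ⟨w, fun h => absurd h he⟩
  choose f hf using h
  refine Finset.card_le_card_of_injOn f (fun e' he' => ?_) ?_
  · simp [endpoints, (hf e' he').1]
  · intro e₁ h1 e₂ h2 heq
    have a1 := hf e₁ h1
    have a2 := hf e₂ h2
    have b1 := hT e₁ h1
    have b2 := hT e₂ h2
    rw [← heq] at a2
    obtain ⟨c₁, c₂, hne, hc⟩ := Finset.card_eq_two.mp (hφ (f e₁))
    have hmem : ∀ e, e ∈ incident (f e₁) ∧ φ e = true ↔ e = c₁ ∨ e = c₂ := by
      intro e
      have := Finset.ext_iff.mp hc e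
      simpa using this
    have m := (hmem e).1 ⟨a1.1, b1.2.1⟩
    have m1 := (hmem e₁).1 ⟨a1.2, b1.2.2.1⟩
    have m2 := (hmem e₂).1 ⟨a2.2, b2.2.2.1⟩
    have n1 := b1.1
    have n2 := b2.1
    grind

theorem leg_component {n : ℕ} {φ : Edge n → Bool} (hφ : IceRule φ) (i j k : Fin (4 * n))
    (hij : leg i ≠ leg j) (hik : leg i ≠ leg k) (hjk : leg j ≠ leg k)
    (h1 : (blackGraph φ).Reachable (leg i) (leg j))
    (h2 : (blackGraph φ).Reachable (leg i) (leg k)) : False := by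
  classical
  set c := (blackGraph φ).connectedComponentMk (leg i) with hc
  set H := c.toSimpleGraph with hH
  have hconn : H.Connected := c.connected_toSimpleGraph
  have hcard := hconn.card_vert_le_card_edgeSet_add_one
  have hdeg : ∀ v : c, H.degree v ≤ (endpoints v.1).card := by
    intro v
    rw [← SimpleGraph.card_neighborFinset_eq_degree,
      ← Finset.card_map (Function.Embedding.subtype _)]
    refine card_le_endpoints hφ _ _ ?_
    intro e' he'
    obtain ⟨u, hu, rfl⟩ := Finset.mem_map.mp he'
    rw [SimpleGraph.mem_neighborFinset] at hu
    exact hu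
  have hsum := H.sum_degrees_eq_twice_card_edges
  let vi : c := ⟨leg i, rfl⟩
  let vj : c := ⟨leg j, SimpleGraph.ConnectedComponent.sound h1.symm⟩
  let vk : c := ⟨leg k, SimpleGraph.ConnectedComponent.sound h2.symm⟩
  have hle : ∑ v : c, H.degree v + 3 ≤ ∑ v : c, 2 := by
    have hs : ∑ v : c, H.degree v + ∑ v : c, (if v ∈ ({vi, vj, vk} : Finset c) then 1 else 0) ≤
        ∑ v : c, 2 := by
      rw [← Finset.sum_add_distrib]
      refine Finset.sum_le_sum fun v _ => ?_
      have a := hdeg v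
      have b := card_endpoints v.1
      split_ifs with hv
      · simp only [Finset.mem_insert, Finset.mem_singleton] at hv
        rcases hv with rfl | rfl | rfl
        · have := card_endpoints_leg i
          simp only [vi] at *; omega
        · have := card_endpoints_leg j
          simp only [vj] at *; omega
        · have := card_endpoints_leg k
          simp only [vk] at *; omega
      · omega
    have h3 : ({vi, vj, vk} : Finset c).card = 3 := by
      rw [Finset.card_eq_three]
      exact ⟨vi, vj, vk, fun h => hij (congrArg Subtype.val h), fun h => hik (congrArg Subtype.val h),
        fun h => hjk (congrArg Subtype.val h), rfl⟩
    rw [Finset.sum_ite_mem, Finset.univ_inter, Finset.sum_const, h3] at hs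
    simpa using hs
  rw [hsum] at hle
  simp only [Finset.sum_const, Finset.card_univ, smul_eq_mul] at hle
  rw [Nat.card_eq_fintype_card, Nat.card_eq_fintype_card, ← SimpleGraph.edgeFinset_card] at hcard
  omega

theorem leg_injective {n : ℕ} : Function.Injective (leg (n := n)) := by
  intro k k' h
  have := k.isLt
  have := k'.isLt
  unfold leg at h
  ext
  split_ifs at h <;> simp [Fin.ext_iff] at h <;> omega

theorem blackIndex_lt {n : ℕ} {σ : Sgn} {i j : Fin (2 * n)} :
    blackIndex σ i < blackIndex σ j ↔ i < j := by
  cases σ <;> simp only [blackIndex, Fin.lt_def] <;> omega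

theorem blackIndex_inj {n : ℕ} {σ : Sgn} {i j : Fin (2 * n)} :
    blackIndex σ i = blackIndex σ j ↔ i = j := by
  cases σ <;> simp [blackIndex, Fin.ext_iff]

theorem black_leg_iff {n : ℕ} {σ : Sgn} (φ : Fpl n σ) (k : Fin (4 * n)) :
    φ.1 (leg k) = true ↔ ∃ i, k = blackIndex σ i := by
  have h := φ.2.2
  have hk := k.isLt
  cases σ
  · rw [h k]
    constructor
    · rintro ⟨r, hr⟩
      exact ⟨⟨r, by omega⟩, by ext; simp [blackIndex]; omega⟩
    · rintro ⟨i, rfl⟩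
      exact ⟨i, by simp [blackIndex]; omega⟩
  · rw [h k]
    constructor
    · rintro ⟨r, hr⟩
      exact ⟨⟨r, by omega⟩, by ext; simp [blackIndex]; omega⟩
    · rintro ⟨i, rfl⟩
      exact ⟨i, by simp [blackIndex]⟩

theorem existsUnique_partner {n : ℕ} {σ : Sgn} (φ : Fpl n σ) (i : Fin (2 * n)) :
    ∃! j, j ≠ i ∧ Joined φ i j := by
  classical
  have hb := (black_leg_iff φ _).2 ⟨i, rfl⟩
  have hφ := φ.2.1
  have hex : ∃ j, j ≠ i ∧ Joined φ i j := by
    by_contra! hno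
    have hs := sum_leg _ (compVal_sum hφ hb)
    rw [Finset.sum_eq_single (blackIndex σ i)] at hs
    · exact compVal_eq_zero.1 hs (SimpleGraph.Reachable.refl _)
    · intro k _ hk
      rw [compVal_eq_zero]
      intro hr
      obtain ⟨j, rfl⟩ := (black_leg_iff φ k).1 (blackGraph_black hb hr)
      exact hno j (fun h => hk (by rw [h])) hr
    · simp
  obtain ⟨j, hj, hij⟩ := hex
  refine ⟨j, ⟨hj, hij⟩, ?_⟩
  rintro k ⟨hk, hik⟩
  by_contra hkj
  refine leg_component hφ _ _ _ ?_ ?_ ?_ hij hik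
  · exact fun h => hj (blackIndex_inj.1 (leg_injective h)).symm
  · exact fun h => hk (blackIndex_inj.1 (leg_injective h)).symm
  · exact fun h => hkj (blackIndex_inj.1 (leg_injective h)).symm

theorem not_crossing {n : ℕ} {σ : Sgn} (φ : Fpl n σ) {a b c d : Fin (2 * n)}
    (hab : a < b) (hbc : b < c) (hcd : c < d) (hac : Joined φ a c) (hbd : Joined φ b d) :
    False := by
  classical
  have hb := (black_leg_iff φ _).2 ⟨a, rfl⟩
  have hφ := φ.2.1
  have huniq : ∀ x, Joined φ a x → x = a ∨ x = c := by
    intro x hx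
    by_cases hxa : x = a
    · exact Or.inl hxa
    · exact Or.inr ((existsUnique_partner φ a).unique ⟨hxa, hx⟩ ⟨(hab.trans hbc).ne', hac⟩)
  have hval : ∀ k : Fin (4 * n), compVal φ.1 (leg (blackIndex σ a)) (leg k) =
      (if k = blackIndex σ a then 1 else 0) + (if k = blackIndex σ c then 1 else 0) := by
    intro k
    have hne : blackIndex σ a ≠ blackIndex σ c := fun h => (hab.trans hbc).ne (blackIndex_inj.1 h)
    by_cases h1 : (blackGraph φ.1).Reachable (leg (blackIndex σ a)) (leg k)
    · obtain ⟨x, rfl⟩ := (black_leg_iff φ k).1 (blackGraph_black hb h1)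
      unfold compVal
      rw [if_pos h1]
      rcases huniq x h1 with rfl | rfl
      · simp [hne]
      · simp [hne.symm]
    · rw [compVal_eq_zero.2 h1, if_neg, if_neg]
      · simp
      · rintro rfl; exact h1 hac
      · rintro rfl; exact h1 (SimpleGraph.Reachable.refl _)
  have hnot : ∀ x, x ≠ a → x ≠ c →
      ¬ (blackGraph φ.1).Reachable (leg (blackIndex σ a)) (leg (blackIndex σ x)) := by
    intro x h1 h2 h
    rcases huniq x h with h | h
    · exact h1 h
    · exact h2 h
  have hnb := hnot b hab.ne' hbc.ne
  have hnd := hnot d (hab.trans (hbc.trans hcd)).ne' hcd.ne'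
  have hp := compVal_sum hφ hb
  have heq := sideVal_reachable hφ hb hbd hnb
  rw [sideVal_leg _ hp _ (compVal_eq_zero.2 hnb), sideVal_leg _ hp _ (compVal_eq_zero.2 hnd),
    bdryVal_eq_sum _ hp _ (blackIndex σ b).isLt.le,
    bdryVal_eq_sum _ hp _ (blackIndex σ d).isLt.le] at heq
  simp only [hval, Finset.sum_add_distrib, Finset.sum_ite_eq', Finset.mem_filter,
    Finset.mem_univ, true_and, Fin.val_fin_lt, blackIndex_lt] at heq
  rw [if_pos hab, if_neg hbc.not_gt, if_pos (hab.trans (hbc.trans hcd)), if_pos hcd] at heq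
  revert heq
  decide

/-- The link pattern `π(φ)`: the partner of the `i`-th black leg is the other black leg at the end
of the black path starting from it. -/
noncomputable def linkPattern {n : ℕ} {σ : Sgn} (φ : Fpl n σ) : LP n where
  partner i := (existsUnique_partner φ i).choose
  partner_partner i := by
    have h1 := (existsUnique_partner φ i).choose_spec.1
    have h2 := (existsUnique_partner φ (existsUnique_partner φ i).choose).choose_spec.2
    exact (h2 i ⟨h1.1.symm, h1.2.symm⟩).symm
  partner_ne i := (existsUnique_partner φ i).choose_spec.1.1
  noncrossing a b := fun ⟨h1, h2, h3⟩ =>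
    not_crossing φ h1 h2 h3 (existsUnique_partner φ a).choose_spec.1.2
      (existsUnique_partner φ b).choose_spec.1.2

/-! ## Vectors and operators -/

/-- The linear space `ℂ^{LP(n)}`, with basis the `|π⟩`, that is `Finsupp.single π 1`. -/
abbrev LPSpace (n : ℕ) : Type := LP n →₀ ℂ

/-- The linear space `ℂ^{Fpl(n, ±)}`, with basis the `|φ⟩⟩`, that is `Finsupp.single φ 1`. -/
abbrev FplSpace (n : ℕ) (σ : Sgn) : Type := Fpl n σ →₀ ℂ

/-- The operator `R |π⟩ = |R π⟩`. -/
noncomputable def opR (n : ℕ) : Module.End ℂ (LPSpace n) := Finsupp.lmapDomain ℂ ℂ rotate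

/-- The operator `e_j |π⟩ = |e_j(π)⟩`. -/
noncomputable def opE {n : ℕ} (j : Fin (2 * n)) : Module.End ℂ (LPSpace n) :=
  Finsupp.lmapDomain ℂ ℂ (temperleyLieb j)

/-- The Hamiltonian, the sum of the `e_j` over the `2n` labels. -/
noncomputable def hamiltonian (n : ℕ) : Module.End ℂ (LPSpace n) := ∑ j : Fin (2 * n), opE j

/-- `Sym = 1 + R + ⋯ + R^{2n-1}`. -/
noncomputable def opSym (n : ℕ) : Module.End ℂ (LPSpace n) :=
  ∑ k ∈ Finset.range (2 * n), opR n ^ k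

/-- The map `Π_± |φ⟩⟩ = |π(φ)⟩`. -/
noncomputable def opPi (n : ℕ) (σ : Sgn) : FplSpace n σ →ₗ[ℂ] LPSpace n :=
  Finsupp.lmapDomain ℂ ℂ linkPattern

/-- The state `|s_{n,±}⟩⟩`, the sum of all `|φ⟩⟩`. -/
noncomputable def fplState (n : ℕ) (σ : Sgn) : FplSpace n σ :=
  ∑ φ : Fpl n σ, Finsupp.single φ 1

/-- The state `|s_n⟩`, the sum of `|π(φ)⟩` over `Fpl(n, +)`. -/
noncomputable def lpState (n : ℕ) : LPSpace n :=
  ∑ φ : Fpl n Sgn.plus, Finsupp.single (linkPattern φ) 1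

/-- `RS_n = (H_n - 2n) |s_n⟩`. -/
noncomputable def razStr (n : ℕ) : LPSpace n :=
  hamiltonian n (lpState n) - (2 * n : ℂ) • lpState n

/-- `N_α(φ)`, for the plaquette `α` whose lower-left corner is the vertex `(x, y)` (counted from
`0`): it is `1` if the two horizontal edges are black and the two vertical ones white, `-1` in the
opposite case, and `0` otherwise; in particular it is `0` if there is no such plaquette, since the
vertex `(x, y)` is in the last column or the last row of the square, or outside of it. -/
def plaquetteSign {n : ℕ} {σ : Sgn} (x y : ℕ) (φ : Fpl n σ) : ℤ :=
  if h : x + 1 < n ∧ y + 1 < n then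
    let lower : Bool := φ.1 (Sum.inl (⟨x + 1, by omega⟩, ⟨y, by omega⟩))
    let upper : Bool := φ.1 (Sum.inl (⟨x + 1, by omega⟩, ⟨y + 1, by omega⟩))
    let left : Bool := φ.1 (Sum.inr (⟨x, by omega⟩, ⟨y + 1, by omega⟩))
    let right : Bool := φ.1 (Sum.inr (⟨x + 1, by omega⟩, ⟨y + 1, by omega⟩))
    if lower = true ∧ upper = true ∧ left = false ∧ right = false then 1
    else if lower = false ∧ upper = false ∧ left = true ∧ right = true then -1
    else 0
  else 0

/-- The diagonal operator `Ñ_α |φ⟩⟩ = N_α(φ) |φ⟩⟩`. -/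
noncomputable def opN (n : ℕ) (σ : Sgn) (x y : ℕ) : FplSpace n σ →ₗ[ℂ] FplSpace n σ :=
  Finsupp.linearCombination ℂ fun φ => (plaquetteSign x y φ : ℂ) • Finsupp.single φ (1 : ℂ)

open Classical in
/-- The sum of `N_α(φ)` over the `φ` in `Fpl(n, ±)` with link pattern in the class `[π]` modulo
rotations. -/
noncomputable def classSum (n : ℕ) (σ : Sgn) (x y : ℕ) (π : LP n) : ℤ :=
  ∑ φ : Fpl n σ with ∃ k : ℕ, rotate^[k] (linkPattern φ) = π, plaquetteSign x y φ

end RazStr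

namespace RazStr

/-! Both sides of the identity are zero. Everything rests on Wieland's half-gyrations. Each edge
separates two faces of opposite parity; for a fixed parity `p`, the half-gyration keeps the colours
on the alternating inner faces of that parity and exchanges them on all other edges. It is a
bijection from `Fpl(n,+)` to `Fpl(n,-)` which preserves the link pattern for `p = 1` and rotates it
for `p = 0` (`linkPattern_gyrate_one`, `linkPattern_gyrate_zero`). Hence `Sym |π(φ)⟩` is invariant
under both, and `|s_n⟩` is invariant under rotation.

Right-hand side (`opSym_opN`): for a bottom plaquette, `N_α(φ)` is the number of black edges among
its lower edge in `φ` and in the half-gyration of `φ` at the parity of `α`, minus one. After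
summation against `Sym |π(φ)⟩` this no longer depends on the parity used. With the other parity the
lower edge always changes colour, so the sum is zero.

Left-hand side: split the configurations by the column of the unique straight line through a vertex
of the bottom row, and let `tailState n σ x` collect those where it is not to the left of column
`x`. If the black leg `i` is in column `x`, passing from `x` to `x + 1` does not change `Sym (e_i -
1)` of this state (`symE_tailState`): the discarded configurations either join legs `i` and `i + 1`,
and are fixed by `e_i`, or have a plaquette of sign `-1` whose flip realises `e_i`, and these add up
to a plaquette sum that vanishes by `opSym_opN`. Black legs occupy every other column, so between
two such moves the sign `±` is switched by a half-gyration, which either keeps the tail state or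
rotates it and so replaces `i` by `i + 1`. At `x = n` nothing is left, while at `x = 0` the state is
`|s_n⟩`. Thus `Sym (e_0 - 1)|s_n⟩ = 0`, rotation gives the same for every `j`, and since `RS_n` is
rotation invariant, `Sym RS_n = 2n RS_n = 0`. -/

/-- The opposite boundary condition. -/
def Sgn.neg : Sgn → Sgn
  | Sgn.plus => Sgn.minus
  | Sgn.minus => Sgn.plus

/-! ## Colours in natural coordinates -/

/-- The colour of a horizontal edge, with natural number coordinates. -/
def hCol {n : ℕ} (φ : Edge n → Bool) (x y : ℕ) : Bool :=
  if h : x < n + 1 ∧ y < n then φ (Sum.inl (⟨x, h.1⟩, ⟨y, h.2⟩)) else false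

/-- The colour of a vertical edge, with natural number coordinates. -/
def vCol {n : ℕ} (φ : Edge n → Bool) (x y : ℕ) : Bool :=
  if h : x < n ∧ y < n + 1 then φ (Sum.inr (⟨x, h.1⟩, ⟨y, h.2⟩)) else false

theorem hCol_eq {n : ℕ} (φ : Edge n → Bool) (x : Fin (n + 1)) (y : Fin n) :
    φ (Sum.inl (x, y)) = hCol φ x y := by
  unfold hCol; rw [dif_pos ⟨x.isLt, y.isLt⟩]

theorem vCol_eq {n : ℕ} (φ : Edge n → Bool) (x : Fin n) (y : Fin (n + 1)) :
    φ (Sum.inr (x, y)) = vCol φ x y := by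
  unfold vCol; rw [dif_pos ⟨x.isLt, y.isLt⟩]

theorem card_filter_incident {n : ℕ} (φ : Edge n → Bool) (w : Vertex n) :
    ((incident w).filter (fun e => φ e = true)).card =
      (hCol φ w.1 w.2).toNat + (hCol φ (w.1 + 1) w.2).toNat +
      (vCol φ w.1 w.2).toNat + (vCol φ w.1 (w.2 + 1)).toNat := by
  have h1 : w.1.castSucc ≠ w.1.succ := Fin.castSucc_lt_succ.ne
  have h2 : w.2.castSucc ≠ w.2.succ := Fin.castSucc_lt_succ.ne
  have h (b : Bool) : b.toNat = if b = true then 1 else 0 := by cases b <;> rfl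
  rw [Finset.card_filter]
  unfold incident
  rw [Finset.sum_insert (by simp [h1]), Finset.sum_insert (by simp),
    Finset.sum_insert (by simp [h2]), Finset.sum_singleton]
  simp only [hCol_eq, vCol_eq, Fin.val_castSucc, Fin.val_succ, h]
  ring

theorem iceRule_iff {n : ℕ} (φ : Edge n → Bool) :
    IceRule φ ↔ ∀ x y, x < n → y < n → (hCol φ x y).toNat + (hCol φ (x + 1) y).toNat +
      (vCol φ x y).toNat + (vCol φ x (y + 1)).toNat = 2 := by
  simp only [IceRule, card_filter_incident]
  exact ⟨fun h x y hx hy => h (⟨x, hx⟩, ⟨y, hy⟩), fun h w => h _ _ w.1.isLt w.2.isLt⟩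

/-- The parity of the positions of the black legs. -/
def Sgn.parity : Sgn → ℕ
  | Sgn.plus => 0
  | Sgn.minus => 1

theorem Sgn.parity_neg (σ : Sgn) : σ.neg.parity = 1 - σ.parity := by
  cases σ <;> rfl

theorem Sgn.parity_le (σ : Sgn) : σ.parity ≤ 1 := by
  cases σ <;> simp [parity]

theorem hasBoundary_iff {n : ℕ} (σ : Sgn) (φ : Edge n → Bool) :
    HasBoundary σ φ ↔ ∀ k : Fin (4 * n), φ (leg k) = decide ((k + σ.parity) % 2 = 0) := by
  have h (b : Bool) (P : Prop) [Decidable P] : b = decide P ↔ (b = true ↔ P) := by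
    cases b <;> simp
  cases σ
  · refine forall_congr' fun k => Iff.trans ?_ (h _ _).symm
    rw [Nat.even_iff, Sgn.parity, add_zero]
  · refine forall_congr' fun k => Iff.trans ?_ (h _ _).symm
    rw [Nat.odd_iff, Sgn.parity]
    exact iff_congr Iff.rfl (by omega)

theorem vCol_bottom {n : ℕ} {σ : Sgn} {φ : Edge n → Bool} (h : HasBoundary σ φ) {x : ℕ}
    (hx : x < n) : vCol φ x 0 = decide ((x + σ.parity) % 2 = 0) := by
  have := (hasBoundary_iff σ φ).1 h ⟨x, by omega⟩
  rw [leg, dif_pos hx] at this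
  rw [vCol, dif_pos ⟨hx, by omega⟩]
  exact this

theorem hCol_right {n : ℕ} {σ : Sgn} {φ : Edge n → Bool} (h : HasBoundary σ φ) {y : ℕ}
    (hy : y < n) : hCol φ n y = decide ((n + y + σ.parity) % 2 = 0) := by
  have := (hasBoundary_iff σ φ).1 h ⟨n + y, by omega⟩
  rw [leg, dif_neg (by simp), dif_pos (by simp; omega), hCol_eq φ] at this
  simpa using this

theorem vCol_top {n : ℕ} {σ : Sgn} {φ : Edge n → Bool} (h : HasBoundary σ φ) {x : ℕ}
    (hx : x < n) : vCol φ x n = decide ((n + x + 1 + σ.parity) % 2 = 0) := by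
  have := (hasBoundary_iff σ φ).1 h ⟨3 * n - 1 - x, by omega⟩
  rw [leg, dif_neg (by simp; omega), dif_neg (by simp; omega), dif_pos (by simp; omega),
    vCol_eq φ] at this
  simp only [Fin.val_last] at this
  rw [show 3 * n - 1 - (3 * n - 1 - x) = x by omega] at this
  rw [this]
  congr 1; apply propext; omega

theorem hCol_left {n : ℕ} {σ : Sgn} {φ : Edge n → Bool} (h : HasBoundary σ φ) {y : ℕ}
    (hy : y < n) : hCol φ 0 y = decide ((y + 1 + σ.parity) % 2 = 0) := by
  have := (hasBoundary_iff σ φ).1 h ⟨4 * n - 1 - y, by omega⟩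
  rw [leg, dif_neg (by simp; omega), dif_neg (by simp; omega), dif_neg (by simp; omega),
    hCol_eq φ] at this
  simp only [Fin.val_zero] at this
  rw [show 4 * n - 1 - (4 * n - 1 - y) = y by omega] at this
  rw [this]
  congr 1; apply propext; omega

/-! ## Gyration -/

/-- The face whose upper-right corner is the vertex `f` has four edges, coloured alternately. -/
def Alternating {n : ℕ} (φ : Edge n → Bool) (f : ℕ × ℕ) : Prop :=
  (0 < f.1 ∧ f.1 < n ∧ 0 < f.2 ∧ f.2 < n) ∧ hCol φ f.1 (f.2 - 1) = hCol φ f.1 f.2 ∧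
    vCol φ (f.1 - 1) f.2 = vCol φ f.1 f.2 ∧ hCol φ f.1 f.2 ≠ vCol φ f.1 f.2

instance {n : ℕ} (φ : Edge n → Bool) (f : ℕ × ℕ) : Decidable (Alternating φ f) := by
  unfold Alternating; infer_instance

/-- Of the two faces separated by an edge, the one with the parity of `p`; a face is given by the
coordinates of its upper-right corner. -/
def face {n : ℕ} (p : ℕ) : Edge n → ℕ × ℕ
  | Sum.inl (x, y) => if ((x : ℕ) + y + p) % 2 = 0 then (↑x, ↑y) else (↑x, ↑y + 1)
  | Sum.inr (x, y) => if ((x : ℕ) + y + p) % 2 = 0 then (↑x, ↑y) else (↑x + 1, ↑y)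

theorem face_inl {n : ℕ} {p : ℕ} {x : Fin (n + 1)} {y : Fin n} {f : ℕ × ℕ} :
    face p (Sum.inl (x, y)) = f ↔
      (f.1 + f.2 + p) % 2 = 0 ∧ f.1 = x ∧ (f.2 = y ∨ f.2 = y + 1) := by
  obtain ⟨a, b⟩ := f
  simp only [face]
  split_ifs <;> simp only [Prod.mk.injEq] <;> omega

theorem face_inr {n : ℕ} {p : ℕ} {x : Fin n} {y : Fin (n + 1)} {f : ℕ × ℕ} :
    face p (Sum.inr (x, y)) = f ↔
      (f.1 + f.2 + p) % 2 = 0 ∧ f.2 = y ∧ (f.1 = x ∨ f.1 = x + 1) := by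
  obtain ⟨a, b⟩ := f
  simp only [face]
  split_ifs <;> simp only [Prod.mk.injEq] <;> omega

/-- The half-gyration: the colour of every edge is exchanged, except at the alternating faces with
the parity of `p`. -/
def gyrate {n : ℕ} (p : ℕ) (φ : Edge n → Bool) (e : Edge n) : Bool :=
  if Alternating φ (face p e) then φ e else !φ e

theorem hCol_gyrate {n : ℕ} {p : ℕ} (φ : Edge n → Bool) {x y : ℕ} (hx : x < n + 1) (hy : y < n)
    {f : ℕ × ℕ} (hf : (f.1 + f.2 + p) % 2 = 0) (h1 : f.1 = x) (h2 : f.2 = y ∨ f.2 = y + 1) :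
    hCol (gyrate p φ) x y = if Alternating φ f then hCol φ x y else !hCol φ x y := by
  have h : face p (Sum.inl (⟨x, hx⟩, ⟨y, hy⟩) : Edge n) = f := face_inl.2 ⟨hf, h1, h2⟩
  have h3 := hCol_eq φ ⟨x, hx⟩ ⟨y, hy⟩
  have h4 := hCol_eq (gyrate p φ) ⟨x, hx⟩ ⟨y, hy⟩
  simp only at h3 h4
  rw [← h3, ← h4, gyrate, h]

theorem vCol_gyrate {n : ℕ} {p : ℕ} (φ : Edge n → Bool) {x y : ℕ} (hx : x < n) (hy : y < n + 1)
    {f : ℕ × ℕ} (hf : (f.1 + f.2 + p) % 2 = 0) (h1 : f.2 = y) (h2 : f.1 = x ∨ f.1 = x + 1) :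
    vCol (gyrate p φ) x y = if Alternating φ f then vCol φ x y else !vCol φ x y := by
  have h : face p (Sum.inr (⟨x, hx⟩, ⟨y, hy⟩) : Edge n) = f := face_inr.2 ⟨hf, h1, h2⟩
  have h3 := vCol_eq φ ⟨x, hx⟩ ⟨y, hy⟩
  have h4 := vCol_eq (gyrate p φ) ⟨x, hx⟩ ⟨y, hy⟩
  simp only at h3 h4
  rw [← h3, ← h4, gyrate, h]

/-- All four edges of a face of parity `p` have it as their `p`-face, so they are kept together or
exchanged together. This makes the half-gyration an involution. -/
theorem alternating_gyrate {n : ℕ} {p : ℕ} (φ : Edge n → Bool) {f : ℕ × ℕ}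
    (hf : (f.1 + f.2 + p) % 2 = 0) : Alternating (gyrate p φ) f ↔ Alternating φ f := by
  by_cases hb : 0 < f.1 ∧ f.1 < n ∧ 0 < f.2 ∧ f.2 < n
  · have a1 := hCol_gyrate φ (x := f.1) (y := f.2 - 1) (by omega) (by omega) hf rfl (by omega)
    have a2 := hCol_gyrate φ (x := f.1) (y := f.2) (by omega) (by omega) hf rfl (by omega)
    have a3 := vCol_gyrate φ (x := f.1 - 1) (y := f.2) (by omega) (by omega) hf rfl (by omega)
    have a4 := vCol_gyrate φ (x := f.1) (y := f.2) (by omega) (by omega) hf rfl (by omega)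
    by_cases h : Alternating φ f
    · simp only [h, if_true] at a1 a2 a3 a4
      unfold Alternating at *
      rw [a1, a2, a3, a4]
    · simp only [h, if_false] at a1 a2 a3 a4
      unfold Alternating at *
      rw [a1, a2, a3, a4]
      simp
  · exact ⟨fun h => absurd h.1 hb, fun h => absurd h.1 hb⟩

theorem face_parity {n : ℕ} (p : ℕ) (e : Edge n) : ((face p e).1 + (face p e).2 + p) % 2 = 0 := by
  rcases e with ⟨x, y⟩ | ⟨x, y⟩
  · exact (face_inl.1 rfl).1
  · exact (face_inr.1 rfl).1

theorem gyrate_gyrate {n : ℕ} (p : ℕ) (φ : Edge n → Bool) : gyrate p (gyrate p φ) = φ := by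
  funext e
  have h := alternating_gyrate φ (face_parity p e)
  by_cases h1 : Alternating φ (face p e)
  · rw [gyrate, if_pos (h.2 h1), gyrate, if_pos h1]
  · rw [gyrate, if_neg (fun h2 => h1 (h.1 h2)), gyrate, if_neg h1, Bool.not_not]

/-- Both faces next to a leg are outer faces, which `Alternating` excludes; so a half-gyration
exchanges the colours of all legs. -/
theorem not_alternating_leg {n : ℕ} (p : ℕ) (φ : Edge n → Bool) (k : Fin (4 * n)) :
    ¬ Alternating φ (face p (leg k)) := by
  rintro ⟨h, -⟩
  generalize hf : face p (leg k) = f at h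
  unfold leg at hf
  split_ifs at hf
  all_goals
    simp only [face_inl, face_inr, Fin.val_zero, Fin.val_last] at hf
    omega

theorem gyrate_hasBoundary {n : ℕ} (p : ℕ) {σ : Sgn} {φ : Edge n → Bool} (h : HasBoundary σ φ) :
    HasBoundary σ.neg (gyrate p φ) := by
  rw [hasBoundary_iff] at h ⊢
  intro k
  rw [gyrate, if_neg (not_alternating_leg p φ k), h k, ← decide_not]
  congr 1; apply propext
  have := σ.parity_neg
  have := σ.parity_le
  omega

theorem Alternating.ne {n : ℕ} {φ : Edge n → Bool} {p : ℕ} {f : ℕ × ℕ} (h : Alternating φ f)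
    {x : Fin (n + 1)} {y : Fin n} {x' : Fin n} {y' : Fin (n + 1)}
    (h1 : face p (Sum.inl (x, y) : Edge n) = f) (h2 : face p (Sum.inr (x', y') : Edge n) = f) :
    φ (Sum.inl (x, y)) ≠ φ (Sum.inr (x', y')) := by
  rw [face_inl] at h1
  rw [face_inr] at h2
  obtain ⟨h3, h4, h5, h6⟩ := h
  rw [hCol_eq φ, vCol_eq φ, ← h1.2.1, ← h2.2.1]
  have e1 : hCol φ f.1 y = hCol φ f.1 f.2 := by
    rcases h1.2.2 with h | h
    · rw [h]
    · rw [← h4]; congr 1; omega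
  have e2 : vCol φ x' f.2 = vCol φ f.1 f.2 := by
    rcases h2.2.2 with h | h
    · rw [h]
    · rw [← h5]; congr 1; omega
  rwa [e1, e2]

/-- The faces of parity `p` split the four edges at a vertex into two pairs, each made of a
horizontal and a vertical edge. A pair is either kept, and then has one edge of each colour, or
wholly exchanged; both moves preserve a total of two black edges. -/
theorem gyrate_iceRule {n : ℕ} (p : ℕ) {φ : Edge n → Bool} (h : IceRule φ) :
    IceRule (gyrate p φ) := by
  rw [iceRule_iff] at h ⊢
  intro x y hx hy
  have h0 := h x y hx hy
  have key (f : ℕ × ℕ) (hf : (f.1 + f.2 + p) % 2 = 0) {a b c d : ℕ} (ha : a < n + 1) (hb : b < n)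
      (hc : c < n) (hd : d < n + 1) (h1 : f.1 = a) (h2 : f.2 = b ∨ f.2 = b + 1) (h3 : f.2 = d)
      (h4 : f.1 = c ∨ f.1 = c + 1) :
      (hCol (gyrate p φ) a b = hCol φ a b ∧ vCol (gyrate p φ) c d = vCol φ c d ∧
        hCol φ a b ≠ vCol φ c d) ∨
      (hCol (gyrate p φ) a b = !hCol φ a b ∧ vCol (gyrate p φ) c d = !vCol φ c d) := by
    have e1 := hCol_gyrate φ ha hb hf h1 h2
    have e2 := vCol_gyrate φ hc hd hf h3 h4
    have e3 : face p (Sum.inl (⟨a, ha⟩, ⟨b, hb⟩) : Edge n) = f := face_inl.2 ⟨hf, h1, h2⟩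
    have e4 : face p (Sum.inr (⟨c, hc⟩, ⟨d, hd⟩) : Edge n) = f := face_inr.2 ⟨hf, h3, h4⟩
    by_cases ht : Alternating φ f
    · rw [if_pos ht] at e1 e2
      have := ht.ne e3 e4
      rw [hCol_eq φ, vCol_eq φ] at this
      exact Or.inl ⟨e1, e2, this⟩
    · rw [if_neg ht] at e1 e2
      exact Or.inr ⟨e1, e2⟩
  have fin : ∀ a b c d a' b' c' d' : Bool,
      ((a' = a ∧ c' = c ∧ a ≠ c) ∨ (a' = !a ∧ c' = !c)) →
      ((b' = b ∧ d' = d ∧ b ≠ d) ∨ (b' = !b ∧ d' = !d)) →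
      a.toNat + b.toNat + c.toNat + d.toNat = 2 →
      a'.toNat + b'.toNat + c'.toNat + d'.toNat = 2 := by decide
  by_cases hp : (x + y + p) % 2 = 0
  · exact fin _ _ _ _ _ _ _ _
      (key (x, y) hp (by omega) hy hx (by omega) rfl (by simp) rfl (by simp))
      (key (x + 1, y + 1) (by dsimp only; omega) (by omega) hy hx (by omega) rfl (by simp) rfl
        (by simp)) h0
  -- For this parity the pairs are left-upper and right-lower, hence the exchanged vertical edges.
  · have := fin (hCol φ x y) (hCol φ (x + 1) y) (vCol φ x (y + 1)) (vCol φ x y) _ _ _ _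
      (key (x, y + 1) (by dsimp only; omega) (by omega) hy hx (by omega) rfl (by simp) rfl
        (by simp))
      (key (x + 1, y) (by dsimp only; omega) (by omega) hy hx (by omega) rfl (by simp) rfl
        (by simp)) (by omega)
    omega

/-- The half-gyration, as a map between the two ensembles. -/
def Fpl.gyrate {n : ℕ} {σ : Sgn} (p : ℕ) (φ : Fpl n σ) : Fpl n σ.neg :=
  ⟨RazStr.gyrate p φ.1, gyrate_iceRule p φ.2.1, gyrate_hasBoundary p φ.2.2⟩

theorem Sgn.neg_neg (σ : Sgn) : σ.neg.neg = σ := by cases σ <;> rfl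

theorem Fpl.gyrate_bijective {n : ℕ} {σ : Sgn} (p : ℕ) :
    Function.Bijective (Fpl.gyrate p : Fpl n σ → Fpl n σ.neg) := by
  constructor
  · intro φ ψ h
    have h1 := congrArg (fun x => RazStr.gyrate p x.1) h
    simp only [Fpl.gyrate, RazStr.gyrate_gyrate] at h1
    exact Subtype.ext h1
  · intro ψ
    refine ⟨⟨RazStr.gyrate p ψ.1, gyrate_iceRule p ψ.2.1, ?_⟩, ?_⟩
    · have := gyrate_hasBoundary p ψ.2.2
      rwa [Sgn.neg_neg] at this
    · exact Subtype.ext (RazStr.gyrate_gyrate p ψ.1)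

end RazStr
namespace RazStr

/-! ## Connectivity and gyration -/

theorem linkPattern_partner {n : ℕ} {σ : Sgn} (φ : Fpl n σ) {i j : Fin (2 * n)} :
    (linkPattern φ).partner i = j ↔ j ≠ i ∧ Joined φ i j := by
  have h := (existsUnique_partner φ i).choose_spec
  constructor
  · rintro rfl
    exact h.1
  · intro hj
    exact (h.2 j hj).symm

theorem LP.ext_partner {n : ℕ} {π ρ : LP n} (h : ∀ i, π.partner i = ρ.partner i) : π = ρ := by
  cases π; cases ρ
  simp only [LP.mk.injEq]
  exact funext h

/-- Around a vertex the two faces of parity `p` are diagonally opposite, and each contains two of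
the four edges. -/
theorem exists_mate {n : ℕ} (p : ℕ) (w : Vertex n) {e : Edge n} (he : e ∈ incident w) :
    ∃ e' ∈ incident w, e' ≠ e ∧ face p e' = face p e := by
  obtain ⟨a, b⟩ := w
  by_cases hp : ((a : ℕ) + b + p) % 2 = 0
  · have h1 : face p (Sum.inl (a.castSucc, b) : Edge n) = face p (Sum.inr (a, b.castSucc)) := by
      simp only [face, Fin.val_castSucc, hp, if_true]
    have h2 : face p (Sum.inl (a.succ, b) : Edge n) = face p (Sum.inr (a, b.succ)) := by
      simp only [face, Fin.val_succ]
      rw [if_neg (by omega), if_neg (by omega)]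
    simp only [incident, Finset.mem_insert, Finset.mem_singleton] at he ⊢
    rcases he with rfl | rfl | rfl | rfl
    · exact ⟨_, by simp, by simp, h1.symm⟩
    · exact ⟨_, by simp, by simp, h2.symm⟩
    · exact ⟨_, by simp, by simp, h1⟩
    · exact ⟨_, by simp, by simp, h2⟩
  · have h1 : face p (Sum.inl (a.castSucc, b) : Edge n) = face p (Sum.inr (a, b.succ)) := by
      simp only [face, Fin.val_castSucc, Fin.val_succ]
      rw [if_neg hp, if_pos (by omega)]
    have h2 : face p (Sum.inl (a.succ, b) : Edge n) = face p (Sum.inr (a, b.castSucc)) := by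
      simp only [face, Fin.val_castSucc, Fin.val_succ]
      rw [if_neg hp, if_pos (by omega)]
    simp only [incident, Finset.mem_insert, Finset.mem_singleton] at he ⊢
    rcases he with rfl | rfl | rfl | rfl
    · exact ⟨_, by simp, by simp, h1.symm⟩
    · exact ⟨_, by simp, by simp, h2.symm⟩
    · exact ⟨_, by simp, by simp, h2⟩
    · exact ⟨_, by simp, by simp, h1⟩

theorem black_eq_of_incident {n : ℕ} {φ : Edge n → Bool} (hφ : IceRule φ) {w : Vertex n}
    {e₁ e₂ e₃ : Edge n} (h₁ : e₁ ∈ incident w) (h₂ : e₂ ∈ incident w) (h₃ : e₃ ∈ incident w)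
    (b₁ : φ e₁ = true) (b₂ : φ e₂ = true) (b₃ : φ e₃ = true) (hne : e₁ ≠ e₂) :
    e₃ = e₁ ∨ e₃ = e₂ := by
  obtain ⟨c₁, c₂, -, hc⟩ := Finset.card_eq_two.mp (hφ w)
  have hmem : ∀ e, e ∈ incident w ∧ φ e = true ↔ e = c₁ ∨ e = c₂ := by
    intro e
    have := Finset.ext_iff.mp hc e
    simpa using this
  have m₁ := (hmem e₁).1 ⟨h₁, b₁⟩
  have m₂ := (hmem e₂).1 ⟨h₂, b₂⟩
  have m₃ := (hmem e₃).1 ⟨h₃, b₃⟩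
  grind

theorem adj_of_face {n : ℕ} {ψ : Edge n → Bool} {p : ℕ} {x : Fin (n + 1)} {y : Fin n} {x' : Fin n}
    {y' : Fin (n + 1)}
    (h : face p (Sum.inl (x, y) : Edge n) = face p (Sum.inr (x', y') : Edge n))
    (b₁ : ψ (Sum.inl (x, y)) = true) (b₂ : ψ (Sum.inr (x', y')) = true) :
    (blackGraph ψ).Adj (Sum.inl (x, y)) (Sum.inr (x', y')) := by
  refine ⟨by simp, b₁, b₂, (x', y), ?_, ?_⟩
  · rw [mem_incident_inl]
    have h1 := face_inl.1 h
    have h2 := face_inr.1 (rfl : face p (Sum.inr (x', y') : Edge n) = _)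
    exact ⟨rfl, by dsimp only; omega⟩
  · rw [mem_incident_inr]
    have h1 := face_inl.1 h
    have h2 := face_inr.1 (rfl : face p (Sum.inr (x', y') : Edge n) = _)
    exact ⟨rfl, by dsimp only; omega⟩

/-- The black edges of a non-alternating face belong to one path. -/
theorem reachable_of_face {n : ℕ} {σ : Sgn} (ψ : Fpl n σ) {p : ℕ} {e e' : Edge n}
    (h : face p e = face p e') (ha : ¬ Alternating ψ.1 (face p e)) (b₁ : ψ.1 e = true)
    (b₂ : ψ.1 e' = true) : (blackGraph ψ.1).Reachable e e' := by
  rcases e with ⟨x, y⟩ | ⟨x, y⟩ <;> rcases e' with ⟨x', y'⟩ | ⟨x', y'⟩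
  · by_cases hyy : y = y'
    · have h1 := face_inl.1 h
      have h2 := face_inl.1 (rfl : face p (Sum.inl (x', y') : Edge n) = _)
      have : x = x' := by ext; omega
      subst this hyy
      exact SimpleGraph.Reachable.refl _
    obtain ⟨f, hf⟩ : ∃ f, face p (Sum.inl (x, y) : Edge n) = f := ⟨_, rfl⟩
    have h1 := face_inl.1 hf
    have h2 := face_inl.1 (h.symm.trans hf)
    rw [Fin.ext_iff] at hyy
    have c₁ := b₁
    have c₂ := b₂
    rw [hCol_eq ψ.1] at c₁ c₂
    rw [hf] at ha
    -- Two parallel black edges cannot be consecutive legs, since legs alternate: the face is an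
    -- inner one.
    have hx0 : 0 < (x : ℕ) := by
      by_contra h0
      have h0 : (x : ℕ) = 0 := by omega
      rw [show (x' : ℕ) = x by omega] at c₂
      rw [h0, hCol_left ψ.2.2 y.isLt, decide_eq_true_eq] at c₁
      rw [h0, hCol_left ψ.2.2 y'.isLt, decide_eq_true_eq] at c₂
      omega
    have hxn : (x : ℕ) < n := by
      by_contra h0
      have h0 : (x : ℕ) = n := by omega
      rw [show (x' : ℕ) = x by omega] at c₂
      rw [h0, hCol_right ψ.2.2 y.isLt, decide_eq_true_eq] at c₁
      rw [h0, hCol_right ψ.2.2 y'.isLt, decide_eq_true_eq] at c₂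
      omega
    have hy := y.isLt
    have hy' := y'.isLt
    -- As the face is not alternating, a third black edge bridges the two parallel ones.
    have hside : ∃ e : Edge n, face p e = f ∧ ψ.1 e = true ∧ ∃ z, e = Sum.inr z := by
      by_contra! hno
      have n1 := hno (Sum.inr (⟨x, hxn⟩, ⟨f.2, by omega⟩))
        (face_inr.2 ⟨h1.1, rfl, Or.inl h1.2.1⟩)
      have n2 := hno (Sum.inr (⟨x - 1, by omega⟩, ⟨f.2, by omega⟩))
        (face_inr.2 ⟨h1.1, rfl, Or.inr (by dsimp only; omega)⟩)
      simp only [Sum.inr.injEq, ne_eq, forall_eq', imp_false] at n1 n2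
      rw [vCol_eq ψ.1, Bool.not_eq_true] at n1 n2
      dsimp only at n1 n2
      refine ha ⟨by omega, ?_, ?_, ?_⟩
      · rw [show (x' : ℕ) = f.1 by omega] at c₂
        rw [show (x : ℕ) = f.1 by omega] at c₁
        rcases h1.2.2 with h3 | h3
        · rw [h3, c₁, show (y : ℕ) - 1 = y' by omega, c₂]
        · rw [h3, show (y : ℕ) + 1 - 1 = y by omega, c₁, show (y : ℕ) + 1 = y' by omega, c₂]
      · rw [h1.2.1, n1, n2]
      · rw [h1.2.1, n1]
        rcases h1.2.2 with h3 | h3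
        · rw [h3, c₁]; simp
        · rw [show (x' : ℕ) = x by omega] at c₂
          rw [h3, show (y : ℕ) + 1 = y' by omega, c₂]; simp
    obtain ⟨_, g1, g2, ⟨x'', y''⟩, rfl⟩ := hside
    exact (adj_of_face (hf.trans g1.symm) b₁ g2).reachable.trans
      (adj_of_face (h.symm.trans (hf.trans g1.symm)) b₂ g2).symm.reachable
  · exact (adj_of_face h b₁ b₂).reachable
  · exact (adj_of_face h.symm b₂ b₁).symm.reachable
  · by_cases hxx : x = x'
    · have h1 := face_inr.1 h
      have h2 := face_inr.1 (rfl : face p (Sum.inr (x', y') : Edge n) = _)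
      have : y = y' := by ext; omega
      subst this hxx
      exact SimpleGraph.Reachable.refl _
    obtain ⟨f, hf⟩ : ∃ f, face p (Sum.inr (x, y) : Edge n) = f := ⟨_, rfl⟩
    have h1 := face_inr.1 hf
    have h2 := face_inr.1 (h.symm.trans hf)
    rw [Fin.ext_iff] at hxx
    have c₁ := b₁
    have c₂ := b₂
    rw [vCol_eq ψ.1] at c₁ c₂
    rw [hf] at ha
    have hy0 : 0 < (y : ℕ) := by
      by_contra h0
      have h0 : (y : ℕ) = 0 := by omega
      rw [show (y' : ℕ) = y by omega] at c₂
      rw [h0, vCol_bottom ψ.2.2 x.isLt, decide_eq_true_eq] at c₁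
      rw [h0, vCol_bottom ψ.2.2 x'.isLt, decide_eq_true_eq] at c₂
      omega
    have hyn : (y : ℕ) < n := by
      by_contra h0
      have h0 : (y : ℕ) = n := by omega
      rw [show (y' : ℕ) = y by omega] at c₂
      rw [h0, vCol_top ψ.2.2 x.isLt, decide_eq_true_eq] at c₁
      rw [h0, vCol_top ψ.2.2 x'.isLt, decide_eq_true_eq] at c₂
      omega
    have hx := x.isLt
    have hx' := x'.isLt
    have hside : ∃ e : Edge n, face p e = f ∧ ψ.1 e = true ∧ ∃ z, e = Sum.inl z := by
      by_contra! hno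
      have n1 := hno (Sum.inl (⟨f.1, by omega⟩, ⟨y, hyn⟩))
        (face_inl.2 ⟨h1.1, rfl, Or.inl h1.2.1⟩)
      have n2 := hno (Sum.inl (⟨f.1, by omega⟩, ⟨y - 1, by omega⟩))
        (face_inl.2 ⟨h1.1, rfl, Or.inr (by dsimp only; omega)⟩)
      simp only [Sum.inl.injEq, ne_eq, forall_eq', imp_false] at n1 n2
      rw [hCol_eq ψ.1, Bool.not_eq_true] at n1 n2
      dsimp only at n1 n2
      refine ha ⟨by omega, ?_, ?_, ?_⟩
      · rw [h1.2.1, n1, n2]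
      · rw [show (y' : ℕ) = f.2 by omega] at c₂
        rw [show (y : ℕ) = f.2 by omega] at c₁
        rcases h1.2.2 with h3 | h3
        · rw [h3, c₁, show (x : ℕ) - 1 = x' by omega, c₂]
        · rw [h3, show (x : ℕ) + 1 - 1 = x by omega, c₁, show (x : ℕ) + 1 = x' by omega, c₂]
      · rw [h1.2.1, n1]
        rcases h1.2.2 with h3 | h3
        · rw [h3, c₁]; simp
        · rw [show (y' : ℕ) = y by omega] at c₂
          rw [h3, show (x : ℕ) + 1 = x' by omega, c₂]; simp
    obtain ⟨_, g1, g2, ⟨x'', y''⟩, rfl⟩ := hside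
    exact (adj_of_face (g1.trans hf.symm) g2 b₁).symm.reachable.trans
      (adj_of_face (g1.trans (hf.symm.trans h)) g2 b₂).reachable

/-- The black edge `e'` of the half-gyration of `φ` continues the black edge `e` of `φ`. -/
def Continues {n : ℕ} (p : ℕ) (φ : Edge n → Bool) (e e' : Edge n) : Prop :=
  face p e' = face p e ∧ gyrate p φ e' = true ∧ (Alternating φ (face p e) → e' = e)

/-- Any two continuations are equivalent: they coincide at an alternating face, and elsewhere the
black edges of one face lie on one path. -/
theorem Continues.reachable {n : ℕ} {σ : Sgn} {p : ℕ} (φ : Fpl n σ) {e a b : Edge n}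
    (ha : Continues p φ.1 e a) (hb : Continues p φ.1 e b) :
    (blackGraph (gyrate p φ.1)).Reachable a b := by
  by_cases h : Alternating φ.1 (face p e)
  · rw [ha.2.2 h, hb.2.2 h]
  · refine reachable_of_face (φ.gyrate p) (ha.1.trans hb.1.symm) ?_ ha.2.1 hb.2.1
    rw [ha.1]
    exact fun h' => h ((alternating_gyrate φ.1 (face_parity p e)).1 h')

/-- A black path is followed from face to face. Two consecutive edges in one face rule out that it
is alternating, so the same continuation serves both. If they lie in different faces, each of these
faces retains a black edge at the common vertex after gyration (the edge itself if alternating, its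
white mate otherwise), and these two edges are adjacent. -/
theorem continues_step {n : ℕ} {σ : Sgn} {p : ℕ} (φ : Fpl n σ) {e₀ e₁ e₂ : Edge n}
    (hadj : (blackGraph φ.1).Adj e₁ e₂)
    (h : ∃ e', Continues p φ.1 e₁ e' ∧ (blackGraph (gyrate p φ.1)).Reachable e₀ e') :
    ∃ e', Continues p φ.1 e₂ e' ∧ (blackGraph (gyrate p φ.1)).Reachable e₀ e' := by
  obtain ⟨e', he', hr⟩ := h
  obtain ⟨hne, b₁, b₂, w, m₁, m₂⟩ := hadj
  by_cases hf : face p e₁ = face p e₂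
  · refine ⟨e', ⟨he'.1.trans hf, he'.2.1, fun ha => ?_⟩, hr⟩
    exfalso
    rcases e₁ with ⟨x, y⟩ | ⟨x, y⟩ <;> rcases e₂ with ⟨x', y'⟩ | ⟨x', y'⟩
    · rw [mem_incident_inl] at m₁ m₂
      have h1 := face_inl.1 hf
      have h2 := face_inl.1 (rfl : face p (Sum.inl (x', y') : Edge n) = _)
      refine hne ?_
      rw [show x = x' by ext; omega, show y = y' by ext; omega]
    · exact ha.ne hf rfl (b₁.trans b₂.symm)
    · exact ha.ne rfl hf (b₂.trans b₁.symm)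
    · rw [mem_incident_inr] at m₁ m₂
      have h1 := face_inr.1 hf
      have h2 := face_inr.1 (rfl : face p (Sum.inr (x', y') : Edge n) = _)
      refine hne ?_
      rw [show x = x' by ext; omega, show y = y' by ext; omega]
  · have key : ∀ e ∈ incident w, φ.1 e = true →
        ∃ a ∈ incident w, Continues p φ.1 e a := by
      intro e he hb
      by_cases ha : Alternating φ.1 (face p e)
      · exact ⟨e, he, rfl, by rw [gyrate, if_pos ha, hb], fun _ => rfl⟩
      · obtain ⟨a, h1, h2, h3⟩ := exists_mate p w he
        refine ⟨a, h1, h3, ?_, fun h => absurd h ha⟩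
        rw [gyrate, h3, if_neg ha, Bool.not_eq_true', ← Bool.not_eq_true]
        intro hab
        rcases black_eq_of_incident φ.2.1 m₁ m₂ he b₁ b₂ hb hne with rfl | rfl
        · rcases black_eq_of_incident φ.2.1 m₁ m₂ h1 b₁ b₂ hab hne with rfl | rfl
          · exact h2 rfl
          · exact hf h3.symm
        · rcases black_eq_of_incident φ.2.1 m₁ m₂ h1 b₁ b₂ hab hne with rfl | rfl
          · exact hf h3
          · exact h2 rfl
    obtain ⟨a₁, i₁, c₁⟩ := key e₁ m₁ b₁
    obtain ⟨a₂, i₂, c₂⟩ := key e₂ m₂ b₂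
    refine ⟨a₂, c₂, hr.trans ((he'.reachable φ c₁).trans (SimpleGraph.Adj.reachable ?_))⟩
    refine ⟨?_, c₁.2.1, c₂.2.1, w, i₁, i₂⟩
    rintro rfl
    exact hf (c₁.1.symm.trans c₂.1)

/-- Outer faces do not alternate, so the new black leg of the same outer face continues the old one
at either end of the path. -/
theorem Joined.gyrate {n : ℕ} {σ : Sgn} {p : ℕ} {φ : Fpl n σ} {i j i' j' : Fin (2 * n)}
    (h : Joined φ i j)
    (hi : face p (leg (blackIndex σ.neg i')) = face p (leg (blackIndex σ i)))
    (hj : face p (leg (blackIndex σ.neg j')) = face p (leg (blackIndex σ j))) :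
    Joined (φ.gyrate p) i' j' := by
  have hb (k) := (black_leg_iff (φ.gyrate p) _).2 ⟨k, rfl⟩
  have hstart : ∃ e', Continues p φ.1 (leg (blackIndex σ i)) e' ∧
      (blackGraph (RazStr.gyrate p φ.1)).Reachable (leg (blackIndex σ.neg i')) e' :=
    ⟨_, ⟨hi, hb i', fun h => absurd h (not_alternating_leg _ _ _)⟩, SimpleGraph.Reachable.refl _⟩
  obtain ⟨q⟩ := h
  have hend : ∃ e', Continues p φ.1 (leg (blackIndex σ j)) e' ∧
      (blackGraph (RazStr.gyrate p φ.1)).Reachable (leg (blackIndex σ.neg i')) e' := by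
    clear hj hi
    generalize leg (blackIndex σ i) = a at q hstart
    generalize leg (blackIndex σ j) = b at q
    induction q with
    | nil => exact hstart
    | cons hadj _ ih => exact ih (continues_step φ hadj hstart)
  obtain ⟨e', he', hr⟩ := hend
  exact hr.trans (he'.reachable φ
    ⟨hj, hb j', fun h => absurd h (not_alternating_leg _ _ _)⟩)

/-- Consecutive legs border a common outer face, also across the end of the numbering and around the
corners. -/
theorem face_leg {n p : ℕ} {k k' : Fin (4 * n)}
    (h : (k' : ℕ) = k + 1 ∨ (k' : ℕ) = 0 ∧ (k : ℕ) + 1 = 4 * n) (hp : (k + 1 + p) % 2 = 0) :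
    face p (leg k') = face p (leg k) := by
  have := k.isLt
  have := k'.isLt
  generalize hf : face p (leg k) = f
  unfold leg at hf ⊢
  split_ifs at hf ⊢ <;> simp only [face_inl, face_inr, Fin.val_zero, Fin.val_last] at hf ⊢ <;>
    omega

/-- Outer faces of parity `1` pair the legs `2i` and `2i + 1`, which carry the same label `i` in the
two ensembles. -/
theorem linkPattern_gyrate_one {n : ℕ} (φ : Fpl n Sgn.plus) :
    linkPattern (φ.gyrate 1) = linkPattern φ := by
  have h (i : Fin (2 * n)) : face 1 (leg (blackIndex Sgn.plus.neg i)) =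
      face 1 (leg (blackIndex Sgn.plus i)) :=
    face_leg (Or.inl rfl) (by simp only [blackIndex]; omega)
  refine LP.ext_partner fun i => ?_
  obtain ⟨h1, h2⟩ := (linkPattern_partner φ).1 (rfl : (linkPattern φ).partner i = _)
  exact (linkPattern_partner _).2 ⟨h1, h2.gyrate (h _) (h _)⟩

/-- Outer faces of parity `0` pair the legs `2i + 1` and `2i + 2`, so label `i + 1` becomes label
`i`. -/
theorem linkPattern_gyrate_zero {n : ℕ} (φ : Fpl n Sgn.plus) :
    linkPattern (φ.gyrate 0) = rotate (linkPattern φ) := by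
  have h (i : Fin (2 * n)) : face 0 (leg (blackIndex Sgn.plus.neg i)) =
      face 0 (leg (blackIndex Sgn.plus (next n i))) := by
    refine (face_leg ?_ ?_).symm
    · simp only [blackIndex, Sgn.neg, next_val]
      split_ifs <;> omega
    · simp only [blackIndex, Sgn.neg]
      omega
  refine LP.ext_partner fun i => ?_
  obtain ⟨h1, h2⟩ := (linkPattern_partner φ).1
    (rfl : (linkPattern φ).partner (next n i) = _)
  refine (linkPattern_partner _).2 ⟨?_, h2.gyrate (h _) ?_⟩
  · exact fun h => (linkPattern φ).partner_ne _ ((Equiv.symm_apply_eq _).1 h)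
  · rw [h]
    simp only [rotate, Equiv.apply_symm_apply]

end RazStr
namespace RazStr

/-! ## Operators -/

/-- The basis vector `|π⟩`. -/
noncomputable def ket {n : ℕ} (π : LP n) : LPSpace n := Finsupp.single π 1

theorem opR_ket {n : ℕ} (π : LP n) : opR n (ket π) = ket (rotate π) := by
  simp [opR, ket, Finsupp.lmapDomain_apply, Finsupp.mapDomain_single]

theorem opE_ket {n : ℕ} (j : Fin (2 * n)) (π : LP n) :
    opE j (ket π) = ket (temperleyLieb j π) := by
  simp [opE, ket, Finsupp.lmapDomain_apply, Finsupp.mapDomain_single]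

theorem LPSpace.hom_ext {n : ℕ} {f g : Module.End ℂ (LPSpace n)}
    (h : ∀ π, f (ket π) = g (ket π)) : f = g :=
  Finsupp.lhom_ext' fun π => LinearMap.ext_ring (h π)

theorem next_pow_val {n : ℕ} (k : ℕ) (i : Fin (2 * n)) :
    (((next n) ^ k) i : ℕ) = (i + k) % (2 * n) := by
  have hi := i.isLt
  induction k with
  | zero => simp [Nat.mod_eq_of_lt hi]
  | succ k ih =>
    rw [pow_succ', Equiv.Perm.mul_apply, next_val, ih, ← add_assoc, Nat.add_mod (i + k) 1]
    have := Nat.mod_lt (i + k) (by omega : 0 < 2 * n)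
    rw [Nat.mod_eq_of_lt (show 1 < 2 * n by omega)]
    split_ifs with h
    · rw [h, Nat.mod_self]
    · rw [Nat.mod_eq_of_lt (a := (i + k) % (2 * n) + 1) (by omega)]

theorem rotate_iterate_partner {n : ℕ} (k : ℕ) (π : LP n) (i : Fin (2 * n)) :
    (rotate^[k] π).partner i = ((next n) ^ k).symm (π.partner (((next n) ^ k) i)) := by
  induction k generalizing π with
  | zero => rfl
  | succ k ih =>
    rw [Function.iterate_succ_apply, ih, pow_succ']
    rfl

theorem rotate_iterate {n : ℕ} (π : LP n) : rotate^[2 * n] π = π := by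
  have h : (next n) ^ (2 * n) = 1 := by
    ext i
    rw [next_pow_val]
    simp [Nat.mod_eq_of_lt i.isLt]
  refine LP.ext_partner fun i => ?_
  rw [rotate_iterate_partner, h]
  rfl

theorem opR_pow_ket {n : ℕ} (k : ℕ) (π : LP n) : (opR n ^ k) (ket π) = ket (rotate^[k] π) := by
  induction k with
  | zero => rfl
  | succ k ih => rw [pow_succ', Module.End.mul_apply, ih, opR_ket, Function.iterate_succ_apply']

theorem opSym_apply {n : ℕ} (v : LPSpace n) :
    opSym n v = ∑ k ∈ Finset.range (2 * n), (opR n ^ k) v := by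
  rw [opSym, LinearMap.sum_apply]

theorem opSym_opR {n : ℕ} (v : LPSpace n) : opSym n (opR n v) = opSym n v := by
  have h : opR n ^ (2 * n) = 1 := LPSpace.hom_ext fun π => by
    rw [opR_pow_ket, rotate_iterate]; rfl
  have h1 := Finset.sum_range_succ (fun k => (opR n ^ k) v) (2 * n)
  rw [Finset.sum_range_succ', h, pow_zero] at h1
  rw [opSym_apply, opSym_apply, ← add_right_cancel h1]
  rfl

theorem rotate_temperleyLieb {n : ℕ} (j : Fin (2 * n)) (π : LP n) :
    rotate (temperleyLieb (next n j) π) = temperleyLieb j (rotate π) := by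
  refine LP.ext_partner fun i => ?_
  have hi : Function.Injective (next n) := (next n).injective
  by_cases h : π.partner (next n j) = next n (next n j)
  · have h' : (rotate π).partner j = next n j := by simp [rotate, h]
    rw [temperleyLieb, dif_pos h, temperleyLieb, dif_pos h']
  · have h' : ¬ (rotate π).partner j = next n j := by
      simp only [rotate, Equiv.symm_apply_eq]; exact h
    rw [temperleyLieb, dif_neg h, temperleyLieb, dif_neg h']
    simp only [rotate, Equiv.symm_apply_eq, Equiv.eq_symm_apply, hi.eq_iff]
    split_ifs <;> simp

theorem opR_mul_opE {n : ℕ} (j : Fin (2 * n)) : opR n * opE (next n j) = opE j * opR n :=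
  LPSpace.hom_ext fun π => by
    simp only [Module.End.mul_apply, opR_ket, opE_ket, rotate_temperleyLieb]

/-- The operator `Sym (e_j - 1)`. -/
noncomputable def symE {n : ℕ} (j : Fin (2 * n)) : Module.End ℂ (LPSpace n) :=
  opSym n * (opE j - 1)

theorem symE_apply {n : ℕ} (j : Fin (2 * n)) (v : LPSpace n) :
    symE j v = opSym n (opE j v - v) := rfl

theorem opR_opE {n : ℕ} (j : Fin (2 * n)) (v : LPSpace n) :
    opR n (opE (next n j) v) = opE j (opR n v) := by
  rw [← Module.End.mul_apply, opR_mul_opE, Module.End.mul_apply]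

/-- Commuting `R` past `e_j` shifts the index, and `Sym` absorbs `R`. -/
theorem symE_opR {n : ℕ} (j : Fin (2 * n)) (v : LPSpace n) :
    symE j (opR n v) = symE (next n j) v := by
  rw [symE_apply, symE_apply, ← opR_opE, ← map_sub, opSym_opR]

/-! ## Sums over the ensembles -/

theorem opPi_opN_fplState {n : ℕ} (σ : Sgn) (x y : ℕ) :
    opPi n σ (opN n σ x y (fplState n σ)) =
      ∑ φ : Fpl n σ, (plaquetteSign x y φ : ℂ) • ket (linkPattern φ) := by
  simp only [fplState, map_sum, opN, Finsupp.linearCombination_single, one_smul, map_smul]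
  refine Finset.sum_congr rfl fun φ _ => ?_
  simp [opPi, ket, Finsupp.lmapDomain_apply, Finsupp.mapDomain_single]

theorem opSym_ket_gyrate {n : ℕ} {σ : Sgn} {p : ℕ} (hp : p < 2) (φ : Fpl n σ) :
    opSym n (ket (linkPattern (φ.gyrate p))) = opSym n (ket (linkPattern φ)) := by
  have h (ψ : Fpl n Sgn.plus) :
      opSym n (ket (linkPattern (ψ.gyrate p))) = opSym n (ket (linkPattern ψ)) := by
    interval_cases p
    · rw [linkPattern_gyrate_zero, ← opR_ket, opSym_opR]
    · rw [linkPattern_gyrate_one]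
  cases σ
  · exact h φ
  · have h1 := h (φ.gyrate p)
    have h2 : (Fpl.gyrate p (φ.gyrate p) : Fpl n Sgn.minus) = φ :=
      Subtype.ext (gyrate_gyrate p φ.1)
    refine h1.symm.trans ?_
    change opSym n (ket (linkPattern (Fpl.gyrate p (φ.gyrate p) : Fpl n Sgn.minus))) = _
    rw [h2]
    rfl

theorem plaquetteSign_eq {n : ℕ} {σ : Sgn} {x : ℕ} (hx : x + 1 < n) (φ : Fpl n σ) :
    plaquetteSign x 0 φ =
      if hCol φ.1 (x + 1) 0 = true ∧ hCol φ.1 (x + 1) 1 = true ∧ vCol φ.1 x 1 = false ∧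
        vCol φ.1 (x + 1) 1 = false then 1
      else if hCol φ.1 (x + 1) 0 = false ∧ hCol φ.1 (x + 1) 1 = false ∧ vCol φ.1 x 1 = true ∧
        vCol φ.1 (x + 1) 1 = true then -1
      else 0 := by
  rw [plaquetteSign, dif_pos ⟨hx, by omega⟩]
  simp only [hCol_eq φ.1, vCol_eq φ.1, Nat.zero_add]

/-- `p` is the parity of the plaquette. If it alternates, its lower edge keeps its colour and is
counted twice or not at all; otherwise the edge changes colour and is counted once. -/
theorem plaquetteSign_gyrate {n : ℕ} {σ : Sgn} {x p : ℕ} (hx : x + 1 < n) (φ : Fpl n σ)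
    (hp : (x + p) % 2 = 0) :
    (plaquetteSign x 0 φ : ℤ) = (hCol φ.1 (x + 1) 0).toNat +
      (hCol (gyrate p φ.1) (x + 1) 0).toNat - 1 := by
  rw [plaquetteSign_eq hx, hCol_gyrate φ.1 (f := (x + 1, 1)) (by omega) (by omega)
    (by dsimp only; omega) rfl (Or.inr rfl)]
  have h : Alternating φ.1 (x + 1, 1) ↔ hCol φ.1 (x + 1) 0 = hCol φ.1 (x + 1) 1 ∧
      vCol φ.1 x 1 = vCol φ.1 (x + 1) 1 ∧ hCol φ.1 (x + 1) 1 ≠ vCol φ.1 (x + 1) 1 :=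
    ⟨fun h => h.2, fun h => ⟨⟨by dsimp only; omega, hx, by simp, by dsimp only; omega⟩, h⟩⟩
  simp only [h]
  generalize hCol φ.1 (x + 1) 0 = a
  generalize hCol φ.1 (x + 1) 1 = b
  generalize vCol φ.1 x 1 = c
  generalize vCol φ.1 (x + 1) 1 = d
  revert a b c d
  decide

/-- For this parity the face attached to the edge is the outer one below it. -/
theorem hCol_gyrate_bottom {n : ℕ} {x p : ℕ} (hx : x < n + 1) (hn : 0 < n) (φ : Edge n → Bool)
    (hp : (x + p) % 2 = 0) : hCol (gyrate p φ) x 0 = !hCol φ x 0 := by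
  rw [hCol_gyrate φ (f := (x, 0)) hx hn (by simpa using hp) rfl (Or.inl rfl), if_neg]
  exact fun h => absurd h.1.2.2.1 (lt_irrefl _)

theorem opSym_opN {n : ℕ} (σ : Sgn) (x : ℕ) :
    opSym n (opPi n σ (opN n σ x 0 (fplState n σ))) = 0 := by
  rw [opPi_opN_fplState]
  simp only [map_sum, map_smul]
  by_cases hx : x + 1 < n
  -- The right-hand side does not involve `p`, because `Sym |π(φ)⟩` is invariant under both
  -- half-gyrations; so the left-hand sides for the two parities agree.
  · have key (p : ℕ) (hp : p < 2) :
        ∑ φ : Fpl n σ, (((hCol φ.1 (x + 1) 0).toNat : ℂ) +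
          (hCol (gyrate p φ.1) (x + 1) 0).toNat - 1) • opSym n (ket (linkPattern φ)) =
        ∑ φ : Fpl n σ, ((hCol φ.1 (x + 1) 0).toNat : ℂ) • opSym n (ket (linkPattern φ)) +
        ∑ φ : Fpl n σ.neg, ((hCol φ.1 (x + 1) 0).toNat : ℂ) • opSym n (ket (linkPattern φ)) -
        ∑ φ : Fpl n σ, opSym n (ket (linkPattern φ)) := by
      rw [← (Fpl.gyrate_bijective (σ := σ) p).sum_comp, ← Finset.sum_add_distrib,
        ← Finset.sum_sub_distrib]
      refine Finset.sum_congr rfl fun φ _ => ?_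
      rw [opSym_ket_gyrate hp, sub_smul, add_smul, one_smul]
      rfl
    -- `x % 2` is the parity of the plaquette, and gives the sum of the signs; the other parity is
    -- that of the outer face below it, and gives zero term by term.
    have h1 := key (x % 2) (by omega)
    rw [← key ((x + 1) % 2) (by omega)] at h1
    refine Eq.trans (Finset.sum_congr rfl fun φ _ => ?_) (h1.trans ?_)
    · rw [plaquetteSign_gyrate hx φ (p := x % 2) (by omega)]
      push_cast
      rfl
    · refine Finset.sum_eq_zero fun φ _ => ?_
      rw [hCol_gyrate_bottom (by omega) (by omega) _ (by omega)]
      cases hCol φ.1 (x + 1) 0 <;> simp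
  · refine Finset.sum_eq_zero fun φ _ => ?_
    rw [plaquetteSign, dif_neg (by omega)]
    simp

end RazStr
namespace RazStr

/-! ## The flip of a plaquette of the bottom row -/

/-- The edge belongs to the plaquette of the bottom row between the columns `x` and `x + 1`. -/
def onPlaquette {n : ℕ} (x : ℕ) : Edge n → Bool
  | Sum.inl (a, b) => decide ((a : ℕ) = x + 1 ∧ (b : ℕ) ≤ 1)
  | Sum.inr (a, b) => decide (((a : ℕ) = x ∨ (a : ℕ) = x + 1) ∧ (b : ℕ) = 1)

/-- The exchange of the colours of the edges of a plaquette of the bottom row. -/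
def flip {n : ℕ} (x : ℕ) (φ : Edge n → Bool) (e : Edge n) : Bool := (φ e).xor (onPlaquette x e)

theorem flip_flip {n : ℕ} (x : ℕ) (φ : Edge n → Bool) : flip x (flip x φ) = φ := by
  funext e
  simp [flip]

theorem hCol_flip {n : ℕ} {x : ℕ} (φ : Edge n → Bool) {a b : ℕ} (ha : a < n + 1) (hb : b < n) :
    hCol (flip x φ) a b = (hCol φ a b).xor (decide (a = x + 1 ∧ b ≤ 1)) := by
  have h1 := hCol_eq φ ⟨a, ha⟩ ⟨b, hb⟩
  have h2 := hCol_eq (flip x φ) ⟨a, ha⟩ ⟨b, hb⟩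
  simp only at h1 h2
  rw [← h1, ← h2, flip, onPlaquette]

theorem vCol_flip {n : ℕ} {x : ℕ} (φ : Edge n → Bool) {a b : ℕ} (ha : a < n) (hb : b < n + 1) :
    vCol (flip x φ) a b = (vCol φ a b).xor (decide ((a = x ∨ a = x + 1) ∧ b = 1)) := by
  have h1 := vCol_eq φ ⟨a, ha⟩ ⟨b, hb⟩
  have h2 := vCol_eq (flip x φ) ⟨a, ha⟩ ⟨b, hb⟩
  simp only at h1 h2
  rw [← h1, ← h2, flip, onPlaquette]

theorem plaquetteSign_ne_zero {n : ℕ} {σ : Sgn} {x : ℕ} {φ : Fpl n σ}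
    (h : plaquetteSign x 0 φ ≠ 0) : x + 1 < n ∧ ∃ c, hCol φ.1 (x + 1) 0 = c ∧
      hCol φ.1 (x + 1) 1 = c ∧ vCol φ.1 x 1 = !c ∧ vCol φ.1 (x + 1) 1 = !c := by
  have hx : x + 1 < n := by
    by_contra hx
    rw [plaquetteSign, dif_neg (by omega)] at h
    exact h rfl
  rw [plaquetteSign_eq hx] at h
  refine ⟨hx, ?_⟩
  split_ifs at h with h1 h2
  · exact ⟨true, h1⟩
  · exact ⟨false, h2⟩
  · exact absurd rfl h

/-- Each corner of the plaquette meets one of its black and one of its white edges, so the exchange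
does not alter the count. -/
theorem flip_iceRule {n : ℕ} {σ : Sgn} {x : ℕ} {φ : Fpl n σ} (h : plaquetteSign x 0 φ ≠ 0) :
    IceRule (flip x φ.1) := by
  obtain ⟨hx, c, h1, h2, h3, h4⟩ := plaquetteSign_ne_zero h
  have h0 := (iceRule_iff _).1 φ.2.1
  rw [iceRule_iff]
  intro a b ha hb
  have h0 := h0 a b ha hb
  rw [hCol_flip _ (by omega) hb, hCol_flip _ (by omega) hb, vCol_flip _ ha (by omega),
    vCol_flip _ ha (by omega)]
  by_cases hc : (a = x ∨ a = x + 1) ∧ b ≤ 1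
  · obtain ⟨rfl | rfl, hb1⟩ := hc <;> interval_cases b <;>
      simp_all <;> cases c <;> simp_all <;> omega
  · rw [decide_eq_false (by omega), decide_eq_false (by omega), decide_eq_false (by omega),
      decide_eq_false (by omega)]
    simpa using h0

theorem flip_hasBoundary {n : ℕ} {σ : Sgn} {x : ℕ} (hx : x + 1 < n) {φ : Edge n → Bool}
    (h : HasBoundary σ φ) : HasBoundary σ (flip x φ) := by
  rw [hasBoundary_iff] at h ⊢
  intro k
  have hk : onPlaquette x (leg k) = false := by
    unfold leg
    split_ifs <;> simp [onPlaquette] <;> omega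
  rw [flip, hk, h k, Bool.xor_false]

open Classical in
/-- The flip of a plaquette of the bottom row, as a map from the ensemble to itself: it fixes the
configurations for which the plaquette has no sign. -/
noncomputable def Fpl.flip {n : ℕ} {σ : Sgn} (x : ℕ) (φ : Fpl n σ) : Fpl n σ :=
  if h : plaquetteSign x 0 φ ≠ 0 then
    ⟨RazStr.flip x φ.1, flip_iceRule h, flip_hasBoundary (plaquetteSign_ne_zero h).1 φ.2.2⟩
  else φ

theorem Fpl.flip_val {n : ℕ} {σ : Sgn} {x : ℕ} {φ : Fpl n σ} (h : plaquetteSign x 0 φ ≠ 0) :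
    (φ.flip x).1 = RazStr.flip x φ.1 :=
  congrArg Subtype.val (dif_pos h)

theorem Fpl.flip_eq_self {n : ℕ} {σ : Sgn} {x : ℕ} {φ : Fpl n σ} (h : ¬ plaquetteSign x 0 φ ≠ 0) :
    φ.flip x = φ :=
  dif_neg h

theorem plaquetteSign_flip {n : ℕ} {σ : Sgn} (x : ℕ) (φ : Fpl n σ) :
    plaquetteSign x 0 (φ.flip x) = - plaquetteSign x 0 φ := by
  by_cases h : plaquetteSign x 0 φ ≠ 0
  · obtain ⟨hx, c, h1, h2, h3, h4⟩ := plaquetteSign_ne_zero h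
    rw [plaquetteSign_eq hx, plaquetteSign_eq hx, Fpl.flip_val h, hCol_flip _ (by omega) (by omega),
      hCol_flip _ (by omega) (by omega), vCol_flip _ (by omega) (by omega),
      vCol_flip _ (by omega) (by omega), h1, h2, h3, h4]
    cases c <;> simp
  · rw [Fpl.flip_eq_self h]
    rw [not_not] at h
    rw [h, neg_zero]

theorem Fpl.flip_flip {n : ℕ} {σ : Sgn} (x : ℕ) (φ : Fpl n σ) : (φ.flip x).flip x = φ := by
  by_cases h : plaquetteSign x 0 φ ≠ 0
  · have h1 : plaquetteSign x 0 (φ.flip x) ≠ 0 := by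
      rw [plaquetteSign_flip]; exact neg_ne_zero.2 h
    refine Subtype.ext ?_
    rw [Fpl.flip_val h1, Fpl.flip_val h, RazStr.flip_flip]
  · rw [Fpl.flip_eq_self h, Fpl.flip_eq_self h]

theorem blackIndex_val {n : ℕ} (σ : Sgn) (i : Fin (2 * n)) :
    (blackIndex σ i : ℕ) = 2 * i + σ.parity := by
  cases σ <;> rfl

/-! ### Black paths near the bottom row, and the effect of a flip on them. -/

section Connectivity

variable {n : ℕ} {σ : Sgn} {x : ℕ} {i : Fin (2 * n)}

theorem leg_of_lt (hi : 2 * (i : ℕ) + σ.parity = x) (hx : x < n) :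
    leg (blackIndex σ i) = Sum.inr (⟨x, hx⟩, 0) := by
  subst hi
  rw [leg, dif_pos (by rwa [blackIndex_val])]
  simp [blackIndex_val]

theorem next_index (hi : 2 * (i : ℕ) + σ.parity = x) (hx : x < n) :
    2 * (next n i : ℕ) + σ.parity = x + 2 := by
  rw [next_val, if_neg (by omega)]
  omega

theorem black_leg (ψ : Fpl n σ) (i : Fin (2 * n)) : ψ.1 (leg (blackIndex σ i)) = true :=
  (black_leg_iff ψ _).2 ⟨i, rfl⟩

theorem reachable_next_leg (ψ : Fpl n σ) (hi : 2 * (i : ℕ) + σ.parity = x) (hx : x + 1 < n)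
    (hD : hCol ψ.1 (x + 2) 0 = true) : (blackGraph ψ.1).Reachable
      (Sum.inl (⟨x + 2, by omega⟩, ⟨0, by omega⟩)) (leg (blackIndex σ (next n i))) := by
  have hn := next_index hi (by omega)
  -- The next black leg is the vertical one in column `x + 2`, unless `x + 2 = n`: then it is the
  -- given edge itself, the lowest leg of the right side.
  by_cases h : x + 2 < n
  · have hb := black_leg ψ (next n i)
    rw [leg_of_lt hn h] at hb ⊢
    refine SimpleGraph.Adj.reachable ⟨by simp, ?_, hb, (⟨x + 2, h⟩, ⟨0, by omega⟩), ?_, ?_⟩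
    · rw [hCol_eq ψ.1]; exact hD
    · rw [mem_incident_inl]; simp
    · rw [mem_incident_inr]; simp
  · have hl : leg (blackIndex σ (next n i)) = Sum.inl (⟨x + 2, by omega⟩, ⟨0, by omega⟩) := by
      rw [leg, dif_neg (by rw [blackIndex_val]; omega), dif_pos (by rw [blackIndex_val]; omega)]
      simp only [blackIndex_val, Sum.inl.injEq, Prod.mk.injEq, Fin.ext_iff, Fin.val_last]
      omega
    rw [hl]

theorem joined_next_of_lower (ψ : Fpl n σ) (hi : 2 * (i : ℕ) + σ.parity = x) (hx : x + 1 < n)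
    (hB : hCol ψ.1 (x + 1) 0 = true) (hD : hCol ψ.1 (x + 2) 0 = true) :
    Joined ψ i (next n i) := by
  have hb := black_leg ψ i
  unfold Joined
  rw [leg_of_lt hi (by omega)] at hb ⊢
  refine SimpleGraph.Reachable.trans ?_ (reachable_next_leg ψ hi hx hD)
  refine SimpleGraph.Reachable.trans (v := Sum.inl (⟨x + 1, by omega⟩, ⟨0, by omega⟩)) ?_ ?_
  · refine SimpleGraph.Adj.reachable ⟨by simp, hb, ?_, (⟨x, by omega⟩, ⟨0, by omega⟩), ?_, ?_⟩
    · rw [hCol_eq ψ.1]; exact hB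
    · rw [mem_incident_inr]; simp
    · rw [mem_incident_inl]; simp
  · refine SimpleGraph.Adj.reachable ⟨by simp, ?_, ?_, (⟨x + 1, by omega⟩, ⟨0, by omega⟩), ?_, ?_⟩
    · rw [hCol_eq ψ.1]; exact hB
    · rw [hCol_eq ψ.1]; exact hD
    · rw [mem_incident_inl]; simp
    · rw [mem_incident_inl]; simp

theorem joined_next_of_upper (ψ : Fpl n σ) (hi : 2 * (i : ℕ) + σ.parity = x) (hx : x + 1 < n)
    (hA : vCol ψ.1 x 1 = true) (hB : hCol ψ.1 (x + 1) 1 = true) (hC : vCol ψ.1 (x + 1) 1 = true)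
    (hD : hCol ψ.1 (x + 2) 0 = true) :
    Joined ψ i (next n i) := by
  have hb := black_leg ψ i
  unfold Joined
  rw [leg_of_lt hi (by omega)] at hb ⊢
  refine SimpleGraph.Reachable.trans ?_ (reachable_next_leg ψ hi hx hD)
  refine SimpleGraph.Reachable.trans (v := Sum.inr (⟨x, by omega⟩, ⟨1, by omega⟩)) ?_ ?_
  · refine SimpleGraph.Adj.reachable ⟨by simp [Fin.ext_iff], hb, ?_,
      (⟨x, by omega⟩, ⟨0, by omega⟩), ?_, ?_⟩
    · rw [vCol_eq ψ.1]; exact hA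
    · rw [mem_incident_inr]; simp
    · rw [mem_incident_inr]; simp
  refine SimpleGraph.Reachable.trans (v := Sum.inl (⟨x + 1, by omega⟩, ⟨1, by omega⟩)) ?_ ?_
  · refine SimpleGraph.Adj.reachable ⟨by simp, ?_, ?_, (⟨x, by omega⟩, ⟨1, by omega⟩), ?_, ?_⟩
    · rw [vCol_eq ψ.1]; exact hA
    · rw [hCol_eq ψ.1]; exact hB
    · rw [mem_incident_inr]; simp
    · rw [mem_incident_inl]; simp
  refine SimpleGraph.Reachable.trans (v := Sum.inr (⟨x + 1, by omega⟩, ⟨1, by omega⟩)) ?_ ?_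
  · refine SimpleGraph.Adj.reachable ⟨by simp, ?_, ?_, (⟨x + 1, by omega⟩, ⟨1, by omega⟩), ?_, ?_⟩
    · rw [hCol_eq ψ.1]; exact hB
    · rw [vCol_eq ψ.1]; exact hC
    · rw [mem_incident_inl]; simp
    · rw [mem_incident_inr]; simp
  · refine SimpleGraph.Adj.reachable ⟨by simp, ?_, ?_, (⟨x + 1, by omega⟩, ⟨0, by omega⟩), ?_, ?_⟩
    · rw [vCol_eq ψ.1]; exact hC
    · rw [hCol_eq ψ.1]; exact hD
    · rw [mem_incident_inr]; simp
    · rw [mem_incident_inl]; simp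

/-- At the bottom-right corner. -/
theorem joined_next_of_corner (ψ : Fpl n σ) (hi : 2 * (i : ℕ) + σ.parity = x) (hx : x + 1 = n)
    (hA : vCol ψ.1 x 1 = true) : Joined ψ i (next n i) := by
  have hb := black_leg ψ i
  have hb' := black_leg ψ (next n i)
  have hn := next_index hi (by omega)
  unfold Joined
  rw [leg_of_lt hi (by omega)] at hb ⊢
  refine SimpleGraph.Reachable.trans (v := Sum.inr (⟨x, by omega⟩, ⟨1, by omega⟩)) ?_ ?_
  · refine SimpleGraph.Adj.reachable ⟨by simp [Fin.ext_iff], hb, ?_,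
      (⟨x, by omega⟩, ⟨0, by omega⟩), ?_, ?_⟩
    · rw [vCol_eq ψ.1]; exact hA
    · rw [mem_incident_inr]; simp
    · rw [mem_incident_inr]; simp
  -- The next black leg is in the second row of the right side; for `n = 1` there is no such row,
  -- and it is the top leg.
  by_cases h1 : n = 1
  · have hl : leg (blackIndex σ (next n i)) = Sum.inr (⟨x, by omega⟩, ⟨1, by omega⟩) := by
      rw [leg, dif_neg (by rw [blackIndex_val]; omega), dif_neg (by rw [blackIndex_val]; omega),
        dif_pos (by rw [blackIndex_val]; omega)]
      simp only [blackIndex_val, Sum.inr.injEq, Prod.mk.injEq, Fin.ext_iff, Fin.val_last]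
      omega
    rw [hl]
  · have hl : leg (blackIndex σ (next n i)) = Sum.inl (⟨x + 1, by omega⟩, ⟨1, by omega⟩) := by
      rw [leg, dif_neg (by rw [blackIndex_val]; omega), dif_pos (by rw [blackIndex_val]; omega)]
      simp only [blackIndex_val, Sum.inl.injEq, Prod.mk.injEq, Fin.ext_iff, Fin.val_last]
      omega
    rw [hl] at hb' ⊢
    refine SimpleGraph.Adj.reachable ⟨by simp, ?_, hb', (⟨x, by omega⟩, ⟨1, by omega⟩), ?_, ?_⟩
    · rw [vCol_eq ψ.1]; exact hA
    · rw [mem_incident_inr]; simp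
    · rw [mem_incident_inl]; simp

/-- The colours around the leg in column `x` and around the next one, when the first one is black
and belongs to a straight line. -/
theorem straight_colours (ψ : Fpl n σ) (hi : 2 * (i : ℕ) + σ.parity = x) (hx : x < n)
    (h1 : hCol ψ.1 (x + 1) 0 = false) (h0 : vCol ψ.1 x 1 = true ∨ hCol ψ.1 x 0 = false) :
    hCol ψ.1 x 0 = false ∧ vCol ψ.1 x 1 = true ∧
      (x + 1 < n → hCol ψ.1 (x + 2) 0 = true ∧ vCol ψ.1 (x + 1) 1 = true) := by
  have hice := (iceRule_iff _).1 ψ.2.1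
  have i1 := hice x 0 hx (by omega)
  have b1 : vCol ψ.1 x 0 = true := by
    rw [vCol_bottom ψ.2.2 hx]; simp; omega
  rw [h1, b1] at i1
  refine ⟨?_, ?_, fun hx' => ?_⟩
  · generalize hCol ψ.1 x 0 = a at *
    generalize vCol ψ.1 x (0 + 1) = b at *
    cases a <;> cases b <;> simp_all
  · generalize hCol ψ.1 x 0 = a at *
    generalize vCol ψ.1 x (0 + 1) = b at *
    cases a <;> cases b <;> simp_all
  · have i2 := hice (x + 1) 0 hx' (by omega)
    have b2 : vCol ψ.1 (x + 1) 0 = false := by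
      rw [vCol_bottom ψ.2.2 hx']; simp; omega
    rw [h1, b2] at i2
    generalize hCol ψ.1 (x + 1 + 1) 0 = a at *
    generalize vCol ψ.1 (x + 1) (0 + 1) = b at *
    cases a <;> cases b <;> simp_all

theorem plaquetteSign_eq_neg_one {φ : Fpl n σ} (h : plaquetteSign x 0 φ = -1) :
    x + 1 < n ∧ hCol φ.1 (x + 1) 0 = false ∧ hCol φ.1 (x + 1) 1 = false ∧ vCol φ.1 x 1 = true ∧
      vCol φ.1 (x + 1) 1 = true := by
  obtain ⟨hx, -⟩ := plaquetteSign_ne_zero (φ := φ) (x := x) (by rw [h]; decide)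
  rw [plaquetteSign_eq hx] at h
  split_ifs at h with h1 h2
  exact ⟨hx, h2⟩

/-- The black edges of the plaquette are its two vertical ones, which lie on the paths from `i` and
from `i + 1`; a path from any other leg avoids the plaquette and survives the flip. -/
theorem Joined.flip {φ : Fpl n σ} (hi : 2 * (i : ℕ) + σ.parity = x)
    (h : plaquetteSign x 0 φ = -1) {a b : Fin (2 * n)} (hab : Joined φ a b)
    (h1 : ¬ Joined φ a i) (h2 : ¬ Joined φ a (next n i)) : Joined (φ.flip x) a b := by
  obtain ⟨hx, c1, c2, c3, c4⟩ := plaquetteSign_eq_neg_one h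
  obtain ⟨-, -, hs⟩ := straight_colours φ hi (by omega) c1 (Or.inl c3)
  have hD := (hs hx).1
  have hne : plaquetteSign x 0 φ ≠ 0 := by rw [h]; decide
  have hcol : ∀ e, (blackGraph φ.1).Reachable (leg (blackIndex σ a)) e →
      (φ.flip x).1 e = true := by
    intro e he
    have hb := blackGraph_black (black_leg φ a) he
    rw [Fpl.flip_val hne, RazStr.flip, hb]
    suffices onPlaquette x e = false by rw [this]; rfl
    rcases e with ⟨u, v⟩ | ⟨u, v⟩
    · simp only [onPlaquette, decide_eq_false_iff_not]
      rintro ⟨hu, hv⟩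
      rw [hCol_eq φ.1, hu] at hb
      obtain hv | hv : (v : ℕ) = 0 ∨ (v : ℕ) = 1 := by omega
      · rw [hv, c1] at hb; cases hb
      · rw [hv, c2] at hb; cases hb
    · simp only [onPlaquette, decide_eq_false_iff_not]
      rintro ⟨hu | hu, hv⟩
      · refine h1 (he.trans (SimpleGraph.Adj.reachable ?_))
        have hl := black_leg φ i
        rw [leg_of_lt hi (by omega)] at hl ⊢
        refine ⟨?_, hb, hl, (⟨x, by omega⟩, ⟨0, by omega⟩), ?_, ?_⟩
        · simp only [ne_eq, Sum.inr.injEq, Prod.mk.injEq, Fin.ext_iff, Fin.val_zero]; omega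
        · rw [mem_incident_inr]; simp [hu, hv]
        · rw [mem_incident_inr]; simp
      · refine h2 (he.trans (SimpleGraph.Reachable.trans (SimpleGraph.Adj.reachable ?_)
          (reachable_next_leg φ hi hx hD)))
        refine ⟨by simp, hb, ?_, (⟨x + 1, by omega⟩, ⟨0, by omega⟩), ?_, ?_⟩
        · rw [hCol_eq φ.1]; exact hD
        · rw [mem_incident_inr]; simp [hu, hv]
        · rw [mem_incident_inl]; simp
  obtain ⟨q⟩ := hab
  unfold Joined
  have hstart : (blackGraph φ.1).Reachable (leg (blackIndex σ a)) (leg (blackIndex σ a)) ∧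
    (blackGraph (φ.flip x).1).Reachable (leg (blackIndex σ a)) (leg (blackIndex σ a)) :=
    ⟨SimpleGraph.Reachable.refl _, SimpleGraph.Reachable.refl _⟩
  generalize hu : leg (blackIndex σ a) = u at hstart hcol ⊢
  have key : ∀ s t, (blackGraph φ.1).Walk s t →
      ((blackGraph φ.1).Reachable u s ∧ (blackGraph (φ.flip x).1).Reachable u s) →
      (blackGraph (φ.flip x).1).Reachable u t := by
    intro s t q
    induction q with
    | nil => exact fun h => h.2
    | cons hadj _ ih =>
      rintro ⟨r1, r2⟩
      have r3 := r1.trans hadj.reachable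
      exact ih ⟨r3, r2.trans (SimpleGraph.Adj.reachable
        ⟨hadj.1, hcol _ r1, hcol _ r3, hadj.2.2.2⟩)⟩
  rw [hu] at q
  exact key _ _ q hstart

/-- The new lower edge joins `i` to `i + 1`, and paths away from these two are unchanged. If `i` and
`i + 1` had other partners, these are the only labels left and must be matched with each other. -/
theorem linkPattern_flip {φ : Fpl n σ} (hi : 2 * (i : ℕ) + σ.parity = x)
    (h : plaquetteSign x 0 φ = -1) :
    linkPattern (φ.flip x) = temperleyLieb i (linkPattern φ) := by
  obtain ⟨hx, c1, c2, c3, c4⟩ := plaquetteSign_eq_neg_one h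
  obtain ⟨-, -, hs⟩ := straight_colours φ hi (by omega) c1 (Or.inl c3)
  have hD := (hs hx).1
  have hne : plaquetteSign x 0 φ ≠ 0 := by rw [h]; decide
  have hpair : (linkPattern (φ.flip x)).partner i = next n i := by
    refine (linkPattern_partner _).2 ⟨next_ne i, joined_next_of_lower _ hi hx ?_ ?_⟩
    · rw [Fpl.flip_val hne, hCol_flip _ (by omega) (by omega), c1]; simp
    · rw [Fpl.flip_val hne, hCol_flip _ (by omega) (by omega), hD]; simp
  have hother : ∀ a, a ≠ i → a ≠ next n i → a ≠ (linkPattern φ).partner i →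
      a ≠ (linkPattern φ).partner (next n i) →
      (linkPattern (φ.flip x)).partner a = (linkPattern φ).partner a := by
    intro a h1 h2 h3 h4
    obtain ⟨j1, j2⟩ := (linkPattern_partner φ).1 (rfl : (linkPattern φ).partner a = _)
    refine (linkPattern_partner _).2 ⟨j1, j2.flip hi h ?_ ?_⟩
    · exact fun hj => h3 ((linkPattern_partner φ).2 ⟨h1, hj.symm⟩).symm
    · exact fun hj => h4 ((linkPattern_partner φ).2 ⟨h2, hj.symm⟩).symm
  generalize linkPattern (φ.flip x) = ρ at *
  generalize linkPattern φ = π at *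
  have p1 := π.partner_partner
  have p2 := π.partner_ne
  have p3 := ρ.partner_partner
  have p4 := ρ.partner_ne
  refine LP.ext_partner fun a => ?_
  unfold temperleyLieb
  split_ifs with h1
  · grind
  · dsimp only
    grind

end Connectivity

end RazStr
namespace RazStr

/-! ## The refined states -/

theorem temperleyLieb_of_joined {n : ℕ} {σ : Sgn} {φ : Fpl n σ} {i : Fin (2 * n)}
    (h : Joined φ i (next n i)) : temperleyLieb i (linkPattern φ) = linkPattern φ := by
  rw [temperleyLieb, dif_pos ((linkPattern_partner φ).2 ⟨next_ne i, h⟩)]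

theorem symE_ket {n : ℕ} (i : Fin (2 * n)) (π : LP n) :
    symE i (ket π) = opSym n (ket (temperleyLieb i π)) - opSym n (ket π) := by
  rw [symE_apply, opE_ket, map_sub]

/-- The sum of the link patterns of the configurations in which the leg in column `x` and the
horizontal edge on its left have opposite colours: the straight line of the bottom row is not on
the left of column `x`. -/
noncomputable def tailState (n : ℕ) (σ : Sgn) (x : ℕ) : LPSpace n :=
  ∑ φ : Fpl n σ, if hCol φ.1 x 0 = decide ((x + 1 + σ.parity) % 2 = 0) then
    ket (linkPattern φ) else 0

/-- The flip exchanges the signs `+1` and `-1` and acts as `e_i` on link patterns from `-1` to `+1`,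
so this is the vanishing sum of `opSym_opN`. -/
theorem sum_symE_negative {n : ℕ} {σ : Sgn} {x : ℕ} {i : Fin (2 * n)}
    (hi : 2 * (i : ℕ) + σ.parity = x) :
    (∑ φ : Fpl n σ, if plaquetteSign x 0 φ = -1 then symE i (ket (linkPattern φ)) else 0) = 0 := by
  have h := opSym_opN (n := n) σ x
  rw [opPi_opN_fplState] at h
  simp only [map_sum, map_smul] at h
  refine Eq.trans ?_ h
  have h1 : ∀ φ : Fpl n σ, (plaquetteSign x 0 φ : ℂ) • opSym n (ket (linkPattern φ)) =
      (if plaquetteSign x 0 φ = 1 then opSym n (ket (linkPattern φ)) else 0) -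
      (if plaquetteSign x 0 φ = -1 then opSym n (ket (linkPattern φ)) else 0) := by
    intro φ
    have : plaquetteSign x 0 φ = 1 ∨ plaquetteSign x 0 φ = -1 ∨ plaquetteSign x 0 φ = 0 := by
      unfold plaquetteSign
      dsimp only
      split_ifs <;> simp
    rcases this with h | h | h <;> rw [h] <;> simp
  have hflip : Function.Bijective (Fpl.flip x : Fpl n σ → Fpl n σ) :=
    (show Function.Involutive _ from Fpl.flip_flip x).bijective
  simp only [h1, Finset.sum_sub_distrib]
  rw [← hflip.sum_comp (fun φ : Fpl n σ =>
    if plaquetteSign x 0 φ = 1 then opSym n (ket (linkPattern φ)) else 0),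
    ← Finset.sum_sub_distrib]
  refine Finset.sum_congr rfl fun φ _ => ?_
  rw [plaquetteSign_flip]
  by_cases hs : plaquetteSign x 0 φ = -1
  · rw [if_pos hs, if_pos (by rw [hs]; rfl), if_pos hs, linkPattern_flip hi hs, symE_ket]
  · rw [if_neg hs, if_neg (by omega), if_neg hs, sub_zero]

theorem symE_tailState {n : ℕ} {σ : Sgn} {x : ℕ} {i : Fin (2 * n)}
    (hi : 2 * (i : ℕ) + σ.parity = x) (hx : x < n) :
    symE i (tailState n σ x) = symE i (tailState n σ (x + 1)) := by
  rw [← sub_eq_zero, tailState, tailState, map_sum, map_sum, ← Finset.sum_sub_distrib]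
  refine Eq.trans ?_ (sum_symE_negative (n := n) hi)
  refine Finset.sum_congr rfl fun φ _ => ?_
  rw [decide_eq_false (by omega), decide_eq_true (by omega)]
  -- In this case the path from the leg turns right, and the configuration is counted in both
  -- states.
  by_cases h1 : hCol φ.1 (x + 1) 0 = true
  · have h0 : hCol φ.1 x 0 = false := by
      have hice := (iceRule_iff _).1 φ.2.1 x 0 hx (by omega)
      have hb : vCol φ.1 x 0 = true := by
        rw [vCol_bottom φ.2.2 hx, decide_eq_true_eq]; omega
      rw [h1, hb] at hice
      generalize hCol φ.1 x 0 = a at *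
      cases a <;> simp_all; omega
    have hs : plaquetteSign x 0 φ ≠ -1 := fun hs => by
      rw [(plaquetteSign_eq_neg_one hs).2.1] at h1
      cases h1
    rw [if_pos h0, if_pos h1, if_neg hs, sub_self]
  · rw [if_neg h1]
    rw [Bool.not_eq_true] at h1
    by_cases hs : plaquetteSign x 0 φ = -1
    · have h0 := (straight_colours φ hi hx h1
        (Or.inl (plaquetteSign_eq_neg_one hs).2.2.2.1)).1
      rw [if_pos h0, if_pos hs, map_zero, sub_zero]
    · rw [if_neg hs]
      split_ifs with h0
      · obtain ⟨-, hA, hC⟩ := straight_colours φ hi hx h1 (Or.inr h0)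
        -- The line is straight in column `x` and the sign is not `-1`: either the upper edge of the
        -- plaquette is black and closes the path to the next leg, or the line is in the last
        -- column.
        have hj : Joined φ i (next n i) := by
          by_cases hx' : x + 1 < n
          · refine joined_next_of_upper φ hi hx' hA ?_ (hC hx').2 (hC hx').1
            rw [← Bool.not_eq_false]
            intro hB
            rw [plaquetteSign_eq hx', if_neg (by simp [h1]), if_pos ⟨h1, hB, hA, (hC hx').2⟩] at hs
            exact hs rfl
          · exact joined_next_of_corner φ hi (by omega) hA
        rw [symE_ket, temperleyLieb_of_joined hj, sub_self, map_zero, sub_zero]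
      · rw [map_zero, sub_zero]

theorem tailState_zero {n : ℕ} (hn : 0 < n) : tailState n Sgn.plus 0 = lpState n := by
  refine Finset.sum_congr rfl fun φ _ => ?_
  rw [if_pos (hCol_left φ.2.2 hn)]
  rfl

theorem tailState_last {n : ℕ} (hn : 0 < n) (σ : Sgn) : tailState n σ n = 0 := by
  refine Finset.sum_eq_zero fun φ _ => ?_
  rw [hCol_right φ.2.2 hn, if_neg]
  rw [decide_eq_decide]
  omega

/-- With `p` of the parity of `x`, the gyration always exchanges the colour of the edge on the left
of column `x`, exactly as the tail condition requires. The parity of `x` thus decides whether link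
patterns are kept or rotated. -/
theorem tailState_minus {n p : ℕ} {x : ℕ} (hx : x ≤ n) (hn : 0 < n) (hp : (x + p) % 2 = 0) :
    tailState n Sgn.minus x =
      ∑ φ : Fpl n Sgn.plus, if hCol φ.1 x 0 = decide ((x + 1) % 2 = 0) then
        ket (linkPattern (φ.gyrate p)) else 0 := by
  rw [tailState]
  refine Eq.trans ((Fpl.gyrate_bijective (σ := Sgn.plus) p).sum_comp _).symm ?_
  refine Finset.sum_congr rfl fun φ _ => if_congr ?_ rfl rfl
  simp only [Fpl.gyrate]
  rw [hCol_gyrate_bottom (by omega) hn _ hp]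
  have : decide ((x + 1 + Sgn.minus.parity) % 2 = 0) = !decide ((x + 1) % 2 = 0) := by
    rw [← decide_not, decide_eq_decide, Sgn.parity]
    omega
  rw [this, Bool.not_inj_iff]

theorem tailState_minus_odd {n x : ℕ} (hx : x ≤ n) (hn : 0 < n) (hp : x % 2 = 1) :
    tailState n Sgn.minus x = tailState n Sgn.plus x := by
  rw [tailState_minus (p := 1) hx hn (by omega)]
  refine Finset.sum_congr rfl fun φ _ => ?_
  rw [linkPattern_gyrate_one]
  rfl

theorem tailState_minus_even {n x : ℕ} (hx : x ≤ n) (hn : 0 < n) (hp : x % 2 = 0) :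
    tailState n Sgn.minus x = opR n (tailState n Sgn.plus x) := by
  rw [tailState_minus (p := 0) hx hn hp, tailState, map_sum]
  refine Finset.sum_congr rfl fun φ _ => ?_
  rw [linkPattern_gyrate_zero, ← opR_ket, apply_ite (opR n), map_zero]
  rfl

/-- Two columns are crossed per step: one in the `+` ensemble, one in the `-` ensemble, where the
return to `+` is a rotation turning `i` into `i + 1`. `d` only bounds the number of remaining
columns. -/
theorem symE_tailState_eq_zero {n : ℕ} (hn : 0 < n) (d : ℕ) (i : Fin (2 * n))
    (h1 : 2 * (i : ℕ) ≤ n) (h2 : n ≤ 2 * i + d) : symE i (tailState n Sgn.plus (2 * i)) = 0 := by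
  induction d generalizing i with
  | zero => rw [show 2 * (i : ℕ) = n by omega, tailState_last hn, map_zero]
  | succ d ih =>
    by_cases h3 : 2 * (i : ℕ) = n
    · rw [h3, tailState_last hn, map_zero]
    rw [symE_tailState (σ := Sgn.plus) (x := 2 * i) rfl (by omega),
      ← tailState_minus_odd (by omega) hn (by omega)]
    by_cases h4 : 2 * (i : ℕ) + 1 = n
    · rw [h4, tailState_last hn, map_zero]
    rw [symE_tailState (σ := Sgn.minus) (x := 2 * i + 1) rfl (by omega),
      tailState_minus_even (by omega) hn (by omega), symE_opR]
    have h5 : (next n i : ℕ) = i + 1 := by rw [next_val, if_neg (by omega)]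
    have := ih (next n i) (by omega) (by omega)
    rwa [h5] at this

/-! ## The Hamiltonian -/

/-- The two half-gyrations have the same image ensemble; one keeps link patterns and the other
rotates them. -/
theorem opR_lpState (n : ℕ) : opR n (lpState n) = lpState n := by
  have h (p : ℕ) : ∑ φ : Fpl n Sgn.plus, ket (linkPattern (φ.gyrate p)) =
      ∑ φ : Fpl n Sgn.minus, ket (linkPattern φ) :=
    (Fpl.gyrate_bijective (σ := Sgn.plus) p).sum_comp fun φ => ket (linkPattern φ)
  have h1 := (h 0).trans (h 1).symm
  simp only [linkPattern_gyrate_zero, linkPattern_gyrate_one, ← opR_ket, ← map_sum] at h1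
  exact h1

theorem symE_lpState {n : ℕ} (j : Fin (2 * n)) : symE j (lpState n) = 0 := by
  have hn : 0 < n := by have := j.isLt; omega
  obtain ⟨j, hj⟩ := j
  induction j with
  | zero =>
    have := symE_tailState_eq_zero hn n ⟨0, hj⟩ (Nat.zero_le _) (by simp)
    rwa [Nat.mul_zero, tailState_zero hn] at this
  | succ j ih =>
    have h : next n ⟨j, by omega⟩ = ⟨j + 1, hj⟩ := by
      ext
      rw [next_val, if_neg (by dsimp only; omega)]
    rw [← h, ← symE_opR, opR_lpState]
    exact ih _

theorem razStr_eq_sum (n : ℕ) : razStr n = ∑ j : Fin (2 * n), (opE j (lpState n) - lpState n) := by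
  rw [razStr, hamiltonian, LinearMap.sum_apply, Finset.sum_sub_distrib, Finset.sum_const,
    Finset.card_univ, Fintype.card_fin, ← Nat.cast_smul_eq_nsmul ℂ]
  push_cast
  rfl

theorem opR_razStr (n : ℕ) : opR n (razStr n) = razStr n := by
  rw [razStr_eq_sum, map_sum, ← Equiv.sum_comp (next n)]
  simp only [map_sub, opR_opE, opR_lpState]

theorem razStr_eq_zero (n : ℕ) : razStr n = 0 := by
  have h1 : opSym n (razStr n) = 0 := by
    rw [razStr_eq_sum, map_sum]
    exact Finset.sum_eq_zero fun j _ => symE_lpState j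
  have h2 : ∀ k, (opR n ^ k) (razStr n) = razStr n := by
    intro k
    induction k with
    | zero => rfl
    | succ k ih => rw [pow_succ, Module.End.mul_apply, opR_razStr, ih]
  rw [opSym_apply] at h1
  simp only [h2, Finset.sum_const, Finset.card_range] at h1
  -- By invariance `Sym` multiplies `RS_n` by `2n`, which can be cancelled only for `n > 0`.
  rcases Nat.eq_zero_or_pos n with rfl | hn
  · rw [razStr_eq_sum]
    rfl
  · rw [← Nat.cast_smul_eq_nsmul ℂ] at h1
    exact (smul_eq_zero.1 h1).resolve_left (Nat.cast_ne_zero.2 (by omega))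

end RazStr

theorem proposition1 (n : ℕ) (σ : RazStr.Sgn) :
    -- `RS_n = ∑_{j = 1}^{⌈n/2⌉} Sym Π_± Ñ_{α_j} |s_{n,±}⟩⟩`; the plaquette `α_j` has its
    -- lower-left corner in column `2j - 1`, counted from `1`, of the bottom row
    RazStr.razStr n =
      ∑ j ∈ Finset.Icc 1 ⌈(n : ℚ) / 2⌉₊,
        RazStr.opSym n (RazStr.opPi n σ
          (RazStr.opN n σ ((2 * j - 1) - 1) 0 (RazStr.fplState n σ))) ∧
    -- vanishing of all the sums of `N_α` over rotation classes gives `H_n |s_n⟩ = 2n |s_n⟩`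
    ((∀ (π : RazStr.LP n) (x y : ℕ), x + 1 < n → y + 1 < n → RazStr.classSum n σ x y π = 0) →
      RazStr.hamiltonian n (RazStr.lpState n) = (2 * n : ℂ) • RazStr.lpState n) := by
  refine ⟨?_, fun _ => sub_eq_zero.1 (RazStr.razStr_eq_zero n)⟩
  rw [RazStr.razStr_eq_zero, Finset.sum_eq_zero fun j _ => RazStr.opSym_opN σ _]
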